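/- **Conventions.** $PSL_2\mathbb{R}$ acts on the upper half-plane $\mathbb{H}^2$ by orientation-preserving isometries, and $p:\widetilde{PSL_2\mathbb{R}}\to PSL_2\mathbb{R}$ is its universal cover, whose elements are homotopy classes (relative to endpoints) of paths in $PSL_2\mathbb{R}$ starting at $1$. Let $\mathbf z$ be the class of one full anticlockwise turn about a point (the kernel of $p$ is $\{\mathbf z^n : n\in\mathbb{Z}\}$ and is central). - If $\alpha$ is hyperbolic or parabolic, its simplest lift is the class of $c|_{[0,1]}$, where $c:\mathbb{R}\to PSL_2\mathbb{R}$ is the unique continuous homomorphism with $c(1)=\alpha$. The sets of simplest lifts of hyperbolic, resp. parabolic, elements are $\mathrm{Hyp}_0$, resp. $\mathrm{Par}_0$; put $\mathrm{Hyp}_n=\mathbf z^n\mathrm{Hyp}_0$ and $\mathrm{Par}_n=\mathbf z^n\mathrm{Par}_0$. - $\mathrm{Par}_n^{+}$ (resp. $\mathrm{Par}_n^-$) is the set of elements of $\mathrm{Par}_n$ whose projection to $PSL_2\mathbb{R}$ is an anticlockwise (resp. clockwise) parabolic, i.e. conjugate in $PSL_2\mathbb{R}$ to $z\mapsto z+t$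 with $t>0$ (resp. $t<0$). - $\mathrm{Ell}_1$ (resp. $\mathrm{Ell}_{-1}$) is the set of classes of paths $t\mapsto$ (rotation about $q$ through the angle $t\theta$, measured anticlockwise), $t\in[0,1]$, with $q\in\mathbb{H}^2$ and $\theta\in(0,2\pi)$ (resp. $\theta\in(-2\pi,0)$). - For $\alpha,\beta\in PSL_2\mathbb{R}$ the commutator has a well-defined lift $[\tilde\alpha,\tilde\beta]=\tilde\alpha\tilde\beta\tilde\alpha^{-1}\tilde\beta^{-1}\in\widetilde{PSL_2\mathbb{R}}$, independent of the lifts $\tilde\alpha,\tilde\beta$ of $\alpha,\beta$. $\mathrm{Tr}[\alpha,\beta]$ is the trace of the image of $[\tilde\alpha,\tilde\beta]$ under the covering $\widetilde{PSL_2\mathbb{R}}\to SL_2\mathbb{R}$. **Proposition (Goldman).** Let $\alpha,\beta\in PSL_2\mathbb{R}$. The following are equivalent: 1. $\alpha$ and $\beta$ are hyperbolic and their axes cross (meet in exactly one point of $\mathbb{H}^2$); 2. $[\tilde\alpha,\tilde\beta]\in \mathrm{Ell}_1\cup\mathrm{Ell}_{-1}\cup\mathrm{Par}_1^-\cup\mathrm{Par}_{-1}^+\cup\mathrm{Hyp}_1\cup\mathrm{Hyp}_{-1}$;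 3. $\mathrm{Tr}[\alpha,\beta]<2$. -/

import Mathlib

open Topology unitInterval
open scoped MatrixGroups UpperHalfPlane commutatorElement

noncomputable section

/-! ### The universal covering group of a topological group -/

section UniversalCover

variable (G : Type*) [Group G] [TopologicalSpace G] [IsTopologicalGroup G]

/-- The group, under pointwise multiplication, of continuous paths `[0,1] → G` starting at `1`. -/
def BasedPaths : Subgroup C(I, G) where
  carrier := {γ | γ 0 = 1}
  mul_mem' {a b} ha hb := by
    have ha' : a 0 = 1 := ha
    have hb' : b 0 = 1 := hb
    simp [ha', hb']
  one_mem' := by simp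
  inv_mem' {a} ha := by
    have ha' : a 0 = 1 := ha
    simp [ha']

/-- Homotopy of paths relative to the endpoints is a congruence for pointwise multiplication. -/
def homotopyCon : Con (BasedPaths G) where
  r γ δ := ContinuousMap.HomotopicRel γ.1 δ.1 {0, 1}
  iseqv := ⟨fun _ => .refl _, fun h => h.symm, fun h k => h.trans k⟩
  mul' := by
    rintro γ γ' δ δ' ⟨F⟩ ⟨K⟩
    exact ⟨{
      toFun := fun x => F x * K x
      continuous_toFun := by fun_prop
      map_zero_left := fun x => by simp
      map_one_left := fun x => by simp
      prop' := fun t x hx => by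
        have h1 := F.eq_fst t hx
        have h2 := K.eq_fst t hx
        simp [h1, h2] }⟩

/-- The universal covering group of `G` (used for `G = PSL(2, ℝ)`): homotopy classes, relative to
the endpoints, of paths in `G` starting at `1`, with pointwise multiplication. -/
def UnivCover : Type _ := (homotopyCon G).Quotient

instance : Group (UnivCover G) := inferInstanceAs (Group (homotopyCon G).Quotient)

namespace UnivCover

variable {G}

/-- The homotopy class of a path starting at `1`. -/
def mk : BasedPaths G →* UnivCover G := (homotopyCon G).mk'

/-- The covering projection, sending the class of a path to its endpoint. -/
def proj : UnivCover G →* G :=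
  (homotopyCon G).lift
    { toFun := fun γ => γ.1 1
      map_one' := rfl
      map_mul' := fun _ _ => rfl }
    (by
      rintro γ δ ⟨F⟩
      have h := F.eq_snd 0 (x := 1) (by simp)
      have h' : γ.1 1 = δ.1 1 := by simpa using h
      exact h')

@[simp] lemma proj_mk (γ : BasedPaths G) : proj (mk γ) = γ.1 1 := rfl

lemma mk_surjective : Function.Surjective (mk : BasedPaths G → UnivCover G) :=
  Quotient.exists_rep

/-- The class of the restriction to `[0,1]` of a one-parameter subgroup `c : ℝ → G`. -/
def ofOneParam (c : Multiplicative ℝ →ₜ* G) : UnivCover G :=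
  mk ⟨⟨fun t => c (Multiplicative.ofAdd (t : ℝ)), c.continuous_toFun.comp (by fun_prop)⟩, by
    change c (Multiplicative.ofAdd ((0 : I) : ℝ)) = 1
    simp⟩

@[simp] lemma proj_ofOneParam (c : Multiplicative ℝ →ₜ* G) :
    proj (ofOneParam c) = c (Multiplicative.ofAdd 1) := by
  change c (Multiplicative.ofAdd ((1 : I) : ℝ)) = _
  simp

/-- The lifts of the identity are central. -/
lemma mul_comm_of_proj_eq_one {k : UnivCover G} (hk : proj k = 1) (x : UnivCover G) :
    k * x = x * k := by
  obtain ⟨γ, rfl⟩ := mk_surjective k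
  obtain ⟨δ, rfl⟩ := mk_surjective x
  have hγ0 : γ.1 0 = 1 := γ.2
  have hγ1 : γ.1 1 = 1 := hk
  have hδ0 : δ.1 0 = 1 := δ.2
  suffices mk γ = mk (δ * γ * δ⁻¹) by
    rw [map_mul, map_mul, map_inv] at this
    rw [eq_mul_inv_iff_mul_eq] at this
    exact this
  refine (Con.eq _).2 ⟨{
      toFun := fun x => δ.1 (x.1 * x.2) * γ.1 x.2 * (δ.1 (x.1 * x.2))⁻¹
      continuous_toFun := by fun_prop
      map_zero_left := fun x => by simp [hδ0]
      map_one_left := fun x => by simp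
      prop' := fun t x hx => by
        rcases hx with rfl | hx
        · simp [hδ0, hγ0]
        · rw [Set.mem_singleton_iff] at hx
          subst hx
          simp [hγ1] }⟩

end UnivCover

end UniversalCover

/-! ### `PSL(2, ℝ)` acting on the hyperbolic plane -/

namespace PSL2

/-- The class in `PSL(2, ℝ)` of a matrix. -/
def ofSL : SL(2, ℝ) →* PSL(2, ℝ) := QuotientGroup.mk' _

lemma mem_center_iff (A : SL(2, ℝ)) :
    A ∈ Subgroup.center SL(2, ℝ) ↔ A = 1 ∨ A = -1 := by
  rw [Matrix.SpecialLinearGroup.mem_center_iff]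
  constructor
  · rintro ⟨r, hr, h⟩
    have hr' : r = 1 ∨ r = -1 := by simpa using hr
    rcases hr' with rfl | rfl
    · left; ext i j; simp [← h]
    · right; ext i j
      rw [← h]
      fin_cases i <;> fin_cases j <;> simp
  · rintro (rfl | rfl)
    · exact ⟨1, by simp, by simp⟩
    · refine ⟨-1, by simp, ?_⟩
      ext i j
      fin_cases i <;> fin_cases j <;> simp

/-- The action of `PSL(2, ℝ)` on the upper half-plane by Möbius transformations. -/
instance : MulAction PSL(2, ℝ) ℍ :=
  MulAction.compHom ℍ
    (QuotientGroup.lift (Subgroup.center SL(2, ℝ)) (MulAction.toPermHom SL(2, ℝ) ℍ) (by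
      intro A hA
      ext1 z
      rcases (mem_center_iff A).1 hA with rfl | rfl
      · simp
      · ext
        simp [UpperHalfPlane.specialLinearGroup_apply]))

lemma ofSL_smul (A : SL(2, ℝ)) (z : ℍ) : ofSL A • z = A • z := rfl

/-- `α` is hyperbolic: it is represented by a matrix with two distinct real eigenvalues. -/
def IsHyperbolic (α : PSL(2, ℝ)) : Prop :=
  ∃ A : SL(2, ℝ), ofSL A = α ∧ (A : Matrix (Fin 2) (Fin 2) ℝ).IsHyperbolic

/-- `α` is parabolic: it is represented by a nonscalar matrix with a double eigenvalue. -/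
def IsParabolic (α : PSL(2, ℝ)) : Prop :=
  ∃ A : SL(2, ℝ), ofSL A = α ∧ (A : Matrix (Fin 2) (Fin 2) ℝ).IsParabolic

/-- The axis of `α`: the union of the geodesic lines `γ : ℝ → ℍ` (parametrised by arc length)
along which `α` acts as a nontrivial translation. For hyperbolic `α` there is exactly one such
line up to reparametrisation. -/
def Axis (α : PSL(2, ℝ)) : Set ℍ :=
  {z | ∃ γ : ℝ → ℍ, Isometry γ ∧ z ∈ Set.range γ ∧ ∃ d : ℝ, d ≠ 0 ∧ ∀ t, α • γ t = γ (t + d)}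

/-- The axes of `α` and `β` cross: they meet in exactly one point of the hyperbolic plane. -/
def AxesCross (α β : PSL(2, ℝ)) : Prop := ∃ z, Axis α ∩ Axis β = {z}

/-- The matrix acting on `ℍ` as the anticlockwise rotation through the angle `θ` about `i`. -/
def rotMatrix (θ : ℝ) : SL(2, ℝ) :=
  ⟨!![Real.cos (θ / 2), Real.sin (θ / 2); -Real.sin (θ / 2), Real.cos (θ / 2)], by
    rw [Matrix.det_fin_two_of]
    nlinarith [Real.sin_sq_add_cos_sq (θ / 2)]⟩

/-- The matrix of the translation `z ↦ z + t`. -/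
def transMatrix (t : ℝ) : SL(2, ℝ) := ⟨!![1, t; 0, 1], by simp⟩

/-- The one-parameter subgroup `t ↦ g R(t θ) g⁻¹`, rotating through the angle `t θ`
(anticlockwise if `t θ > 0`) about the point `g • i`. -/
def rotation (g : PSL(2, ℝ)) (θ : ℝ) : Multiplicative ℝ →ₜ* PSL(2, ℝ) where
  toFun t := g * ofSL (rotMatrix (t.toAdd * θ)) * g⁻¹
  map_one' := by
    have h : rotMatrix 0 = 1 := by
      ext i j
      fin_cases i <;> fin_cases j <;> simp [rotMatrix]
    simp [h]
  map_mul' s t := by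
    have h : rotMatrix ((s * t).toAdd * θ)
        = rotMatrix (s.toAdd * θ) * rotMatrix (t.toAdd * θ) := by
      have e : (s.toAdd + t.toAdd) * θ / 2 = s.toAdd * θ / 2 + t.toAdd * θ / 2 := by ring
      ext i j
      rw [Matrix.SpecialLinearGroup.coe_mul, Matrix.mul_apply, Fin.sum_univ_two]
      fin_cases i <;> fin_cases j <;>
        simp [rotMatrix, e, Real.cos_add, Real.sin_add] <;>
        ring
    rw [h, map_mul]
    group
  continuous_toFun := by
    have h : Continuous fun t : Multiplicative ℝ => rotMatrix (t.toAdd * θ) := by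
      refine Continuous.subtype_mk ?_ _
      refine continuous_matrix fun i j => ?_
      fin_cases i <;> fin_cases j <;> simp <;> fun_prop
    have h' : Continuous ofSL := continuous_quotient_mk'
    exact (continuous_const.mul (h'.comp h)).mul continuous_const

/-- Anticlockwise parabolics: the conjugates of `z ↦ z + t` with `t > 0`. (The translation
`z ↦ z + t` is the limit, as `y → ∞`, of anticlockwise rotations about `i y` through small positive
angles, so it is an anticlockwise rotation about the ideal point `∞`.) -/
def IsAnticlockwiseParabolic (α : PSL(2, ℝ)) : Prop :=
  ∃ g : PSL(2, ℝ), ∃ t : ℝ, 0 < t ∧ α = g * ofSL (transMatrix t) * g⁻¹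

/-- Clockwise parabolics: the conjugates of `z ↦ z + t` with `t < 0`. -/
def IsClockwiseParabolic (α : PSL(2, ℝ)) : Prop :=
  ∃ g : PSL(2, ℝ), ∃ t : ℝ, t < 0 ∧ α = g * ofSL (transMatrix t) * g⁻¹

/-! ### The regions of the universal cover -/

/-- The generator of the group of lifts of the identity: one full anticlockwise turn. -/
def zeta : UnivCover PSL(2, ℝ) := UnivCover.ofOneParam (rotation 1 (2 * Real.pi))

/-- `Hyp n`: the translates by `zeta ^ n` of the simplest lifts of hyperbolics. The simplest lift of
`α` is the path `c|_[0,1]`, for the one-parameter subgroup `c` with `c 1 = α`. -/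
def Hyp (n : ℤ) : Set (UnivCover PSL(2, ℝ)) :=
  {x | ∃ c : Multiplicative ℝ →ₜ* PSL(2, ℝ), IsHyperbolic (c (Multiplicative.ofAdd 1)) ∧
    x = zeta ^ n * UnivCover.ofOneParam c}

/-- `Par n`: the translates by `zeta ^ n` of the simplest lifts of parabolics. -/
def Par (n : ℤ) : Set (UnivCover PSL(2, ℝ)) :=
  {x | ∃ c : Multiplicative ℝ →ₜ* PSL(2, ℝ), IsParabolic (c (Multiplicative.ofAdd 1)) ∧
    x = zeta ^ n * UnivCover.ofOneParam c}

/-- The elements of `Par n` whose projections are anticlockwise. -/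
def ParPlus (n : ℤ) : Set (UnivCover PSL(2, ℝ)) :=
  {x ∈ Par n | IsAnticlockwiseParabolic (UnivCover.proj x)}

/-- The elements of `Par n` whose projections are clockwise. -/
def ParMinus (n : ℤ) : Set (UnivCover PSL(2, ℝ)) :=
  {x ∈ Par n | IsClockwiseParabolic (UnivCover.proj x)}

/-- `Ell 1`: the simplest anticlockwise lifts of elliptics, rotations through angles in
`(0, 2π)`. -/
def EllOne : Set (UnivCover PSL(2, ℝ)) :=
  {x | ∃ g : PSL(2, ℝ), ∃ θ ∈ Set.Ioo 0 (2 * Real.pi), x = UnivCover.ofOneParam (rotation g θ)}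

/-- `Ell (-1)`: the simplest clockwise lifts of elliptics, rotations through angles in
`(-2π, 0)`. -/
def EllNegOne : Set (UnivCover PSL(2, ℝ)) :=
  {x | ∃ g : PSL(2, ℝ), ∃ θ ∈ Set.Ioo (-(2 * Real.pi)) 0, x = UnivCover.ofOneParam (rotation g θ)}

/-! ### The lift of a commutator and its trace -/

lemma proj_surjective : Function.Surjective (UnivCover.proj : UnivCover PSL(2, ℝ) → PSL(2, ℝ)) := by
  have hofSL : Continuous ofSL := continuous_quotient_mk'
  have key : ∀ M : ℝ → SL(2, ℝ), Continuous M → M 0 = 1 →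
      ofSL (M 1) ∈ (UnivCover.proj : UnivCover PSL(2, ℝ) →* PSL(2, ℝ)).range := by
    intro M hM h0
    refine ⟨UnivCover.mk ⟨⟨fun t => ofSL (M t), hofSL.comp (hM.comp continuous_subtype_val)⟩, ?_⟩,
      ?_⟩
    · change ofSL (M ((0 : I) : ℝ)) = 1
      simp [h0]
    · change ofSL (M ((1 : I) : ℝ)) = _
      simp
  have hU : ∀ x : ℝ, ofSL (transMatrix x) ∈
      (UnivCover.proj : UnivCover PSL(2, ℝ) →* PSL(2, ℝ)).range := by
    intro x
    have := key (fun s => transMatrix (s * x)) (by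
      refine Continuous.subtype_mk ?_ _
      refine continuous_matrix fun i j => ?_
      fin_cases i <;> fin_cases j <;> simp <;> fun_prop) (by
      ext i j
      fin_cases i <;> fin_cases j <;> simp [transMatrix])
    simpa using this
  let L : ℝ → SL(2, ℝ) := fun t => ⟨!![1, 0; t, 1], by simp⟩
  have hL : ∀ x : ℝ, ofSL (L x) ∈
      (UnivCover.proj : UnivCover PSL(2, ℝ) →* PSL(2, ℝ)).range := by
    intro x
    have := key (fun s => L (s * x)) (by
      refine Continuous.subtype_mk ?_ _
      refine continuous_matrix fun i j => ?_
      fin_cases i <;> fin_cases j <;> simp <;> fun_prop) (by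
      ext i j
      fin_cases i <;> fin_cases j <;> simp [L])
    simpa using this
  have hc : ∀ A : SL(2, ℝ), A 1 0 ≠ 0 → ofSL A ∈
      (UnivCover.proj : UnivCover PSL(2, ℝ) →* PSL(2, ℝ)).range := by
    intro A hA
    have hdet : A 0 0 * A 1 1 - A 0 1 * A 1 0 = 1 := by
      have := A.det_coe
      rwa [Matrix.det_fin_two] at this
    have e : A = transMatrix ((A 0 0 - 1) / A 1 0) * L (A 1 0) *
        transMatrix ((A 1 1 - 1) / A 1 0) := by
      ext i j
      rw [Matrix.SpecialLinearGroup.coe_mul, Matrix.mul_apply, Fin.sum_univ_two,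
        Matrix.SpecialLinearGroup.coe_mul, Matrix.mul_apply, Matrix.mul_apply, Fin.sum_univ_two,
        Fin.sum_univ_two]
      fin_cases i <;> fin_cases j <;> simp [transMatrix, L] <;> field_simp <;> linarith
    rw [e, map_mul, map_mul]
    exact mul_mem (mul_mem (hU _) (hL _)) (hU _)
  intro α
  obtain ⟨A, rfl⟩ := QuotientGroup.mk_surjective α
  change ofSL A ∈ (UnivCover.proj : UnivCover PSL(2, ℝ) →* PSL(2, ℝ)).range
  by_cases hA : A 1 0 = 0
  · have hdet : A 0 0 * A 1 1 - A 0 1 * A 1 0 = 1 := by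
      have := A.det_coe
      rwa [Matrix.det_fin_two] at this
    have hd : A 1 1 ≠ 0 := by
      intro h
      simp [hA, h] at hdet
    have h1 := hc (A * L 1) (by
      rw [Matrix.SpecialLinearGroup.coe_mul, Matrix.mul_apply, Fin.sum_univ_two]
      simpa [L, hA] using hd)
    rw [map_mul] at h1
    exact (Subgroup.mul_mem_cancel_right _ (hL 1)).1 h1
  · exact hc A hA

/-- The lift of the commutator of `α` and `β` to the universal cover: the commutator of any lifts
(it does not depend on the lifts, see `commutatorLift_eq`). -/
def commutatorLift (α β : PSL(2, ℝ)) : UnivCover PSL(2, ℝ) :=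
  ⁅Function.surjInv proj_surjective α, Function.surjInv proj_surjective β⁆

lemma commutatorLift_eq (a b : UnivCover PSL(2, ℝ)) :
    commutatorLift (UnivCover.proj a) (UnivCover.proj b) = ⁅a, b⁆ := by
  have aux : ∀ x : UnivCover PSL(2, ℝ), ∃ k, UnivCover.proj k = 1 ∧
      Function.surjInv proj_surjective (UnivCover.proj x) = k * x := by
    intro x
    refine ⟨Function.surjInv proj_surjective (UnivCover.proj x) * x⁻¹, ?_, by simp⟩
    rw [map_mul, map_inv, Function.surjInv_eq proj_surjective, mul_inv_cancel]
  obtain ⟨k, hk, ha⟩ := aux a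
  obtain ⟨l, hl, hb⟩ := aux b
  have ck := UnivCover.mul_comm_of_proj_eq_one hk
  have cl := UnivCover.mul_comm_of_proj_eq_one hl
  rw [commutatorLift, ha, hb, commutatorElement_def, commutatorElement_def]
  calc k * a * (l * b) * (k * a)⁻¹ * (l * b)⁻¹
      = k * (a * l) * b * a⁻¹ * k⁻¹ * b⁻¹ * l⁻¹ := by group
    _ = k * l * (a * b * a⁻¹) * k⁻¹ * b⁻¹ * l⁻¹ := by rw [← cl a]; group
    _ = l * (k * (a * b * a⁻¹)) * k⁻¹ * b⁻¹ * l⁻¹ := by rw [ck l]; group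
    _ = l * (a * b * a⁻¹ * b⁻¹) * l⁻¹ := by rw [ck (a * b * a⁻¹)]; group
    _ = a * b * a⁻¹ * b⁻¹ := by rw [cl]; group

lemma isCoveringMap_ofSL : IsCoveringMap (ofSL : SL(2, ℝ) → PSL(2, ℝ)) := by
  have hfin : (Subgroup.center SL(2, ℝ) : Set SL(2, ℝ)).Finite := by
    refine (Set.toFinite {1, -1}).subset fun A hA => ?_
    simpa using (mem_center_iff A).1 hA
  exact ((Subgroup.center SL(2, ℝ)).isQuotientCoveringMap hfin.isDiscrete).isCoveringMap

/-- The covering map from the universal cover of `PSL(2, ℝ)` to `SL(2, ℝ)`: it sends the class of a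
path to the endpoint of the lift of the path to `SL(2, ℝ)` starting at `1`. -/
def toSL : UnivCover PSL(2, ℝ) → SL(2, ℝ) :=
  Quotient.lift
    (fun γ : BasedPaths PSL(2, ℝ) =>
      isCoveringMap_ofSL.liftPath γ.1 1 (γ.2.trans (map_one ofSL).symm) 1)
    (fun γ δ h => isCoveringMap_ofSL.liftPath_apply_one_eq_of_homotopicRel h 1
      (γ.2.trans (map_one ofSL).symm) (δ.2.trans (map_one ofSL).symm))

/-- The trace of an element of the universal cover of `PSL(2, ℝ)`. -/
def trace (x : UnivCover PSL(2, ℝ)) : ℝ := (toSL x : Matrix (Fin 2) (Fin 2) ℝ).trace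

end PSL2

end

noncomputable section

/-! ### Conjugates, inverses and square roots of classes of paths -/

namespace UnivCover

variable {G : Type*} [Group G] [TopologicalSpace G] [IsTopologicalGroup G]

/-! Condition 3 is the hub of the equivalence.

From 2 to 3: the homomorphism `toSLHom` sends `zeta` to `-1`. A simplest lift of a hyperbolic or
parabolic is a square `y * y`, and `tr Y² = (tr Y)² - 2`, so its trace is above `2`, respectively
equal to `2`; one factor `zeta` or `zeta⁻¹` changes the sign. A rotation through `θ` has trace `2
cos (θ/2)`.

Between 1 and 3: `tr [A, B] - 2` is, up to a negative factor, the Gram determinant of the traceless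
parts of `A` and `B` for the trace form, of signature `(2, 1)`. If one of the two is not hyperbolic,
the reversed Cauchy–Schwarz inequality gives trace at least `2`
(`trace_sq_of_trace_commutator_lt_two`). If both are hyperbolic, conjugate `A` to a diagonal matrix:
then the trace is below `2` exactly when the off-diagonal entries `b`, `c` of `B` satisfy `b c > 0`.
The axis of `B` meets the imaginary axis where `c y² = b`, which has exactly one positive solution
under the same condition (`axesCross_diagMatrix_iff`).

From 3 to 2: the homotopy class of a path must be found, not only its endpoint. By the polar form of
a matrix, `SL(2, ℝ)` is a circle times a plane, so a class is given by its endpoint and the total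
change of an angle (`liftClass_eq_of_isAngle`). For crossing axes, let both translations grow from
the identity along their one-parameter groups. The commutators then form a path whose angle, after
time `0`, has a sine of constant sign (`turning_commutator`). Up to inversion the angle stays in
`(0, π)`, so it is determined by the endpoint; comparison with a standard path to that endpoint
shows that the class is in `EllOne`, `ParMinus 1` or `Hyp 1` according as the trace is above, equal
to or below `-2` (`liftClass_mem_positiveRegion`). -/

lemma mk_eq_mk_iff {γ δ : BasedPaths G} :
    mk γ = mk δ ↔ ContinuousMap.HomotopicRel γ.1 δ.1 {0, 1} :=
  Con.eq _

/-- Pointwise conjugation of a based path by a fixed element. -/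
def conjPath (g : G) (γ : BasedPaths G) : BasedPaths G :=
  ⟨⟨fun t => g * γ.1 t * g⁻¹, by fun_prop⟩, by
    have h : γ.1 0 = 1 := γ.2
    change g * γ.1 0 * g⁻¹ = 1
    simp [h]⟩

/-- Only the endpoint of the conjugating path matters, because that path can be run to its end
before the conjugated one starts. -/
lemma conj_mk (x : UnivCover G) (γ : BasedPaths G) :
    x * mk γ * x⁻¹ = mk (conjPath (proj x) γ) := by
  obtain ⟨δ, rfl⟩ := mk_surjective x
  have hγ0 : γ.1 0 = 1 := γ.2
  rw [← map_mul, ← map_inv, ← map_mul, mk_eq_mk_iff]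
  refine ⟨{
      -- The parameter `1 - (1 - s)(1 - t)` is `t` for `s = 0` and `1` for `s = 1` or `t = 1`. At `t
      -- = 0` conjugation is harmless since `γ 0 = 1`.
      toFun := fun x => δ.1 (σ (σ x.1 * σ x.2)) * γ.1 x.2 * (δ.1 (σ (σ x.1 * σ x.2)))⁻¹
      continuous_toFun := by fun_prop
      map_zero_left := fun x => by simp
      map_one_left := fun x => by simp [conjPath]
      prop' := fun t x hx => by
        rcases hx with rfl | hx
        · simp [hγ0]
        · rw [Set.mem_singleton_iff] at hx
          subst hx
          simp }⟩

/-- The conjugate of a one-parameter subgroup. -/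
def conjOneParam (g : G) (c : Multiplicative ℝ →ₜ* G) : Multiplicative ℝ →ₜ* G where
  toFun t := g * c t * g⁻¹
  map_one' := by simp
  map_mul' s t := by simp
  continuous_toFun := (continuous_const.mul c.continuous_toFun).mul continuous_const

lemma conj_ofOneParam (x : UnivCover G) (c : Multiplicative ℝ →ₜ* G) :
    x * ofOneParam c * x⁻¹ = ofOneParam (conjOneParam (proj x) c) :=
  conj_mk x _

/-- The inverse of a one-parameter subgroup. -/
def invOneParam (c : Multiplicative ℝ →ₜ* G) : Multiplicative ℝ →ₜ* G where
  toFun t := c t⁻¹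
  map_one' := by simp
  map_mul' s t := by rw [mul_inv, map_mul]
  continuous_toFun := c.continuous_toFun.comp continuous_inv

lemma inv_ofOneParam (c : Multiplicative ℝ →ₜ* G) :
    (ofOneParam c)⁻¹ = ofOneParam (invOneParam c) := by
  rw [ofOneParam, ← map_inv]
  congr 1
  ext t
  change (c _)⁻¹ = c _
  rw [map_inv]

/-- The class of a one-parameter subgroup is the square of the class of its half. -/
lemma exists_mul_self_eq_ofOneParam (c : Multiplicative ℝ →ₜ* G) :
    ∃ y, ofOneParam c = y * y := by
  refine ⟨mk ⟨⟨fun t => c (Multiplicative.ofAdd ((t : ℝ) / 2)),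
    c.continuous_toFun.comp (by fun_prop)⟩, ?_⟩, ?_⟩
  · change c (Multiplicative.ofAdd (((0 : I) : ℝ) / 2)) = 1
    simp
  · rw [← map_mul, ofOneParam]
    congr 1
    ext t
    change c _ = c _ * c _
    rw [← map_mul, ← ofAdd_add, add_halves]

end UnivCover

namespace PSL2

/-! ### Lifting paths from `PSL(2, ℝ)` to `SL(2, ℝ)` -/

lemma continuous_ofSL : Continuous ofSL := continuous_quotient_mk'

lemma ofSL_surjective : Function.Surjective ofSL := QuotientGroup.mk_surjective

lemma ofSL_eq_iff {A B : SL(2, ℝ)} : ofSL A = ofSL B ↔ A = B ∨ A = -B := by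
  rw [eq_comm]
  change (QuotientGroup.mk B : PSL(2, ℝ)) = QuotientGroup.mk A ↔ _
  rw [QuotientGroup.eq, mem_center_iff, inv_mul_eq_iff_eq_mul, inv_mul_eq_iff_eq_mul]
  simp

@[simp] lemma ofSL_neg (A : SL(2, ℝ)) : ofSL (-A) = ofSL A := ofSL_eq_iff.2 (Or.inr rfl)

/-- The class of the projection to `PSL(2, ℝ)` of a based path in `SL(2, ℝ)`. -/
def liftClass : BasedPaths SL(2, ℝ) →* UnivCover PSL(2, ℝ) :=
  UnivCover.mk.comp
    { toFun := fun γ => ⟨⟨fun t => ofSL (γ.1 t), continuous_ofSL.comp γ.1.continuous⟩, by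
        have h : γ.1 0 = 1 := γ.2
        change ofSL (γ.1 0) = 1
        rw [h, map_one]⟩
      map_one' := rfl
      map_mul' := fun _ _ => rfl }

@[simp] lemma proj_liftClass (γ : BasedPaths SL(2, ℝ)) :
    UnivCover.proj (liftClass γ) = ofSL (γ.1 1) := rfl

@[simp] lemma toSL_liftClass (γ : BasedPaths SL(2, ℝ)) : toSL (liftClass γ) = γ.1 1 := by
  change isCoveringMap_ofSL.liftPath _ 1 _ 1 = _
  rw [← (isCoveringMap_ofSL.eq_liftPath_iff' _).2 ⟨rfl, γ.2⟩]

/-- Path lifting through the covering `ofSL`. It allows all computations with classes to be made on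
matrix paths, where `toSL` is evaluation at `1`. -/
lemma liftClass_surjective : Function.Surjective liftClass := by
  intro x
  obtain ⟨γ, rfl⟩ := UnivCover.mk_surjective x
  have h0 : γ.1 0 = ofSL 1 := γ.2.trans (map_one ofSL).symm
  refine ⟨⟨isCoveringMap_ofSL.liftPath γ.1 1 h0, isCoveringMap_ofSL.liftPath_zero _ _ _⟩, ?_⟩
  change UnivCover.mk _ = _
  congr 1
  ext t
  exact congr_fun (isCoveringMap_ofSL.liftPath_lifts γ.1 1 h0) t

lemma toSL_mul (x y : UnivCover PSL(2, ℝ)) : toSL (x * y) = toSL x * toSL y := by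
  obtain ⟨γ, rfl⟩ := liftClass_surjective x
  obtain ⟨δ, rfl⟩ := liftClass_surjective y
  rw [← map_mul, toSL_liftClass, toSL_liftClass, toSL_liftClass]
  rfl

/-- The covering homomorphism from the universal cover to `SL(2, ℝ)`. -/
def toSLHom : UnivCover PSL(2, ℝ) →* SL(2, ℝ) := MonoidHom.mk' toSL toSL_mul

lemma toSL_eq_toSLHom (x : UnivCover PSL(2, ℝ)) : toSL x = toSLHom x := rfl

lemma ofSL_toSL (x : UnivCover PSL(2, ℝ)) : ofSL (toSL x) = UnivCover.proj x := by
  obtain ⟨γ, rfl⟩ := liftClass_surjective x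
  simp

/-- The matrices over lifts of the two classes are `±A` and `±B`, and both signs cancel in a
commutator. -/
lemma trace_commutatorLift (A B : SL(2, ℝ)) :
    trace (commutatorLift (ofSL A) (ofSL B)) = (⁅A, B⁆ : SL(2, ℝ)).1.trace := by
  obtain ⟨a, ha⟩ := proj_surjective (ofSL A)
  obtain ⟨b, hb⟩ := proj_surjective (ofSL B)
  rw [trace, ← ha, ← hb, commutatorLift_eq, toSL_eq_toSLHom, map_commutatorElement]
  have ha' : toSLHom a = A ∨ toSLHom a = -A := ofSL_eq_iff.1 ((ofSL_toSL a).trans ha)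
  have hb' : toSLHom b = B ∨ toSLHom b = -B := ofSL_eq_iff.1 ((ofSL_toSL b).trans hb)
  have key : ⁅toSLHom a, toSLHom b⁆ = ⁅A, B⁆ := by
    have inv_neg' : ∀ C : SL(2, ℝ), (-C)⁻¹ = -C⁻¹ := fun C => by
      rw [inv_eq_iff_mul_eq_one]; simp
    rcases ha' with h | h <;> rcases hb' with h' | h' <;>
      simp [h, h', commutatorElement_def, inv_neg']
  rw [key]

/-! ### Polar coordinates on `SL(2, ℝ)` and the angle of a path -/

/-- The complex-linear part of a matrix, as a complex number. -/
def linPart (M : SL(2, ℝ)) : ℂ := ⟨(M 0 0 + M 1 1) / 2, (M 0 1 - M 1 0) / 2⟩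

/-- The conjugate-linear part of a matrix, as a complex number. -/
def antiPart (M : SL(2, ℝ)) : ℂ := ⟨(M 0 0 - M 1 1) / 2, (M 0 1 + M 1 0) / 2⟩

lemma det_eq_one (M : SL(2, ℝ)) : M 0 0 * M 1 1 - M 0 1 * M 1 0 = 1 := by
  rw [← Matrix.det_fin_two]; exact M.det_coe

/-- The determinant is `‖linPart‖² - ‖antiPart‖²`. Hence the linear part never vanishes, and its
argument together with the conjugate-linear part are coordinates on the group. -/
lemma norm_linPart (M : SL(2, ℝ)) : ‖linPart M‖ = √(1 + ‖antiPart M‖ ^ 2) := by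
  rw [Complex.norm_def, Complex.sq_norm]
  congr 1
  simp only [Complex.normSq_apply, linPart, antiPart]
  linear_combination det_eq_one M

/-- The matrix whose linear part has argument `θ` and whose conjugate-linear part is `q`. -/
def ofAngle (θ : ℝ) (q : ℂ) : SL(2, ℝ) :=
  ⟨!![√(1 + ‖q‖ ^ 2) * Real.cos θ + q.re, √(1 + ‖q‖ ^ 2) * Real.sin θ + q.im;
      q.im - √(1 + ‖q‖ ^ 2) * Real.sin θ, √(1 + ‖q‖ ^ 2) * Real.cos θ - q.re], by
    have h : √(1 + ‖q‖ ^ 2) ^ 2 = 1 + ‖q‖ ^ 2 := Real.sq_sqrt (by positivity)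
    rw [Complex.sq_norm, Complex.normSq_apply] at h
    rw [Matrix.det_fin_two_of, Complex.sq_norm, Complex.normSq_apply]
    linear_combination h + √(1 + (q.re * q.re + q.im * q.im)) ^ 2 * Real.sin_sq_add_cos_sq θ⟩

lemma continuous_ofAngle : Continuous fun x : ℝ × ℂ => ofAngle x.1 x.2 := by
  refine Continuous.subtype_mk ?_ _
  refine continuous_matrix fun i j => ?_
  fin_cases i <;> fin_cases j <;> simp <;> fun_prop

lemma ofAngle_antiPart {M : SL(2, ℝ)} {θ : ℝ}
    (h : linPart M = ‖linPart M‖ * Complex.exp (θ * Complex.I)) :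
    ofAngle θ (antiPart M) = M := by
  have hre := congrArg Complex.re h
  have him := congrArg Complex.im h
  rw [Complex.re_ofReal_mul, Complex.exp_ofReal_mul_I_re, norm_linPart] at hre
  rw [Complex.im_ofReal_mul, Complex.exp_ofReal_mul_I_im, norm_linPart] at him
  ext i j
  fin_cases i <;> fin_cases j <;> simp only [ofAngle] <;> simp [← hre, ← him] <;>
    simp [linPart, antiPart] <;> ring

lemma continuous_entry (i j : Fin 2) : Continuous fun M : SL(2, ℝ) => M i j :=
  (continuous_subtype_val : Continuous fun M : SL(2, ℝ) => M.1).matrix_elem i j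

lemma continuous_ofReal_mk {X : Type*} [TopologicalSpace X] {f g : X → ℝ} (hf : Continuous f)
    (hg : Continuous g) : Continuous fun x => (⟨f x, g x⟩ : ℂ) :=
  Complex.equivRealProdCLM.symm.continuous.comp (hf.prodMk hg)

lemma continuous_linPart : Continuous linPart := by
  have := continuous_entry
  exact continuous_ofReal_mk (by fun_prop) (by fun_prop)

lemma continuous_antiPart : Continuous antiPart := by
  have := continuous_entry
  exact continuous_ofReal_mk (by fun_prop) (by fun_prop)

/-- `θ` is a continuous choice of argument for the linear part along the path `γ`. -/
def IsAngle (γ : BasedPaths SL(2, ℝ)) (θ : C(I, ℝ)) : Prop :=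
  θ 0 = 0 ∧ ∀ t, linPart (γ.1 t) = ‖linPart (γ.1 t)‖ * Complex.exp (θ t * Complex.I)

/-- A based path in `SL(2, ℝ)` is determined up to homotopy by its endpoint and the total variation
of its angle. -/
lemma liftClass_eq_of_isAngle {γ δ : BasedPaths SL(2, ℝ)} {θ φ : C(I, ℝ)} (hγ : IsAngle γ θ)
    (hδ : IsAngle δ φ) (h : γ.1 1 = δ.1 1) (hθ : θ 1 = φ 1) : liftClass γ = liftClass δ := by
  have hγ0 : γ.1 0 = 1 := γ.2
  have hδ0 : δ.1 0 = 1 := δ.2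
  have hq : ∀ ε : BasedPaths SL(2, ℝ), Continuous fun t => antiPart (ε.1 t) :=
    fun ε => continuous_antiPart.comp ε.1.continuous
  have hqγ := hq γ
  have hqδ := hq δ
  have e1 : ∀ (s : I) (r : ℝ), (σ s : ℝ) * r + (s : ℝ) * r = r := fun s r => by
    rw [unitInterval.coe_symm_eq]; ring
  have e2 : ∀ (s : I) (r : ℂ), ((σ s : ℝ) : ℂ) * r + ((s : ℝ) : ℂ) * r = r := fun s r => by
    rw [unitInterval.coe_symm_eq]; push_cast; ring
  suffices H : γ.1.HomotopicRel δ.1 {0, 1} from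
    UnivCover.mk_eq_mk_iff.2 (ContinuousMap.HomotopicRel.comp_continuousMap H ⟨ofSL, continuous_ofSL⟩)
  have hc1 : Continuous fun x : I × I => (σ x.1 : ℝ) * θ x.2 + (x.1 : ℝ) * φ x.2 := by
    fun_prop
  have hc2 : Continuous fun x : I × I =>
      ((σ x.1 : ℝ) : ℂ) * antiPart (γ.1 x.2) + ((x.1 : ℝ) : ℂ) * antiPart (δ.1 x.2) :=
    ((Complex.continuous_ofReal.comp (by fun_prop : Continuous fun x : I × I => (σ x.1 : ℝ))).mul
      (hqγ.comp continuous_snd)).add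
    ((Complex.continuous_ofReal.comp (by fun_prop : Continuous fun x : I × I => (x.1 : ℝ))).mul
      (hqδ.comp continuous_snd))
  -- The straight-line homotopy in the coordinates (angle, conjugate-linear part), which range over
  -- the convex set `ℝ × ℂ`. It fixes the endpoints because both coordinates agree there.
  obtain ⟨F, hF⟩ : ∃ F : C(I × I, SL(2, ℝ)), ∀ s t, F (s, t) =
      ofAngle ((σ s : ℝ) * θ t + (s : ℝ) * φ t)
        (((σ s : ℝ) : ℂ) * antiPart (γ.1 t) + ((s : ℝ) : ℂ) * antiPart (δ.1 t)) :=
    ⟨⟨_, continuous_ofAngle.comp (hc1.prodMk hc2)⟩, fun _ _ => rfl⟩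
  refine ⟨{
      toContinuousMap := F
      map_zero_left := fun x => ?_
      map_one_left := fun x => ?_
      prop' := fun t x hx => ?_ }⟩
  · refine (hF 0 x).trans (Eq.trans ?_ (ofAngle_antiPart (hγ.2 x)))
    congr 1 <;> simp
  · refine (hF 1 x).trans (Eq.trans ?_ (ofAngle_antiPart (hδ.2 x)))
    congr 1 <;> simp
  have e : γ.1 x = δ.1 x ∧ θ x = φ x := by
    rcases hx with rfl | hx
    · exact ⟨hγ0.trans hδ0.symm, hγ.1.trans hδ.1.symm⟩
    · rw [Set.mem_singleton_iff] at hx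
      subst hx
      exact ⟨h, hθ⟩
  refine (hF t x).trans ?_
  rw [e.1, e.2, e1, e2, ofAngle_antiPart (hδ.2 x)]

/-- The principal argument is an angle function along paths whose linear part stays in the slit
plane. -/
lemma exists_isAngle_arg (γ : BasedPaths SL(2, ℝ)) (h : ∀ t, linPart (γ.1 t) ∈ Complex.slitPlane) :
    ∃ θ : C(I, ℝ), IsAngle γ θ ∧ ∀ t, θ t = Complex.arg (linPart (γ.1 t)) := by
  have hγ0 : γ.1 0 = 1 := γ.2
  refine ⟨⟨fun t => Complex.arg (linPart (γ.1 t)), ?_⟩, ⟨?_, fun t => ?_⟩, fun t => rfl⟩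
  · have := continuous_linPart.comp γ.1.continuous
    exact continuous_iff_continuousAt.2 fun t =>
      ContinuousAt.comp (g := Complex.arg) (Complex.continuousAt_arg (h t)) this.continuousAt
  · have : linPart 1 = 1 := by
      apply Complex.ext <;> simp [linPart]
    simp [hγ0, this]
  · exact (Complex.norm_mul_exp_arg_mul_I _).symm

end PSL2

/-! ### One-parameter subgroups of `SL(2, ℝ)` and the full turn -/

namespace UnivCover

/-- The restriction to `[0,1]` of a one-parameter subgroup. -/
def oneParamPath {G : Type*} [Group G] [TopologicalSpace G] [IsTopologicalGroup G]
    (c : Multiplicative ℝ →ₜ* G) : BasedPaths G :=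
  ⟨⟨fun t => c (Multiplicative.ofAdd (t : ℝ)), c.continuous_toFun.comp (by fun_prop)⟩, by
    change c (Multiplicative.ofAdd ((0 : I) : ℝ)) = 1
    simp⟩

end UnivCover

namespace PSL2

open UnivCover

/-- The projection of a one-parameter subgroup of `SL(2, ℝ)` to `PSL(2, ℝ)`. -/
def projOneParam (c : Multiplicative ℝ →ₜ* SL(2, ℝ)) : Multiplicative ℝ →ₜ* PSL(2, ℝ) :=
  ContinuousMonoidHom.comp ⟨ofSL, continuous_ofSL⟩ c

lemma projOneParam_apply (c : Multiplicative ℝ →ₜ* SL(2, ℝ)) (t : Multiplicative ℝ) :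
    projOneParam c t = ofSL (c t) := rfl

lemma ofOneParam_projOneParam (c : Multiplicative ℝ →ₜ* SL(2, ℝ)) :
    ofOneParam (projOneParam c) = liftClass (oneParamPath c) := rfl

/-- The one-parameter subgroup of `SL(2, ℝ)` given by an additive-to-multiplicative function. -/
def oneParamOfAdd (M : ℝ → SL(2, ℝ)) (hM : Continuous M) (hadd : ∀ s t, M (s + t) = M s * M t) :
    Multiplicative ℝ →ₜ* SL(2, ℝ) where
  toFun t := M t.toAdd
  map_one' := by
    have h := hadd 0 0
    rw [add_zero] at h
    exact left_eq_mul.1 h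
  map_mul' s t := hadd _ _
  continuous_toFun := hM

lemma rotMatrix_add (s t : ℝ) : rotMatrix (s + t) = rotMatrix s * rotMatrix t := by
  ext i j
  rw [Matrix.SpecialLinearGroup.coe_mul, Matrix.mul_apply, Fin.sum_univ_two]
  fin_cases i <;> fin_cases j <;>
    simp [rotMatrix, add_div, Real.cos_add, Real.sin_add] <;> ring

lemma continuous_rotMatrix : Continuous rotMatrix := by
  refine Continuous.subtype_mk ?_ _
  refine continuous_matrix fun i j => ?_
  fin_cases i <;> fin_cases j <;> simp <;> fun_prop

/-- The one-parameter subgroup of rotations about `i`, with angular speed `θ`. -/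
def rotOneParam (θ : ℝ) : Multiplicative ℝ →ₜ* SL(2, ℝ) :=
  oneParamOfAdd (fun t => rotMatrix (t * θ)) (continuous_rotMatrix.comp (by fun_prop))
    fun s t => by rw [add_mul, rotMatrix_add]

lemma rotation_ofSL (g : SL(2, ℝ)) (θ : ℝ) :
    rotation (ofSL g) θ = projOneParam (conjOneParam g (rotOneParam θ)) := by
  ext t
  change ofSL g * ofSL _ * (ofSL g)⁻¹ = ofSL (g * _ * g⁻¹)
  rw [map_mul, map_mul, map_inv]
  rfl

lemma toSL_rotation (g : SL(2, ℝ)) (θ : ℝ) :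
    toSL (ofOneParam (rotation (ofSL g) θ)) = g * rotMatrix θ * g⁻¹ := by
  rw [rotation_ofSL, ofOneParam_projOneParam, toSL_liftClass]
  change g * rotMatrix (((1 : I) : ℝ) * θ) * g⁻¹ = _
  simp

lemma zeta_eq_liftClass : zeta = liftClass (oneParamPath (rotOneParam (2 * Real.pi))) := by
  have h := rotation_ofSL 1 (2 * Real.pi)
  rw [map_one] at h
  rw [zeta, h, ofOneParam_projOneParam]
  congr 2
  ext1 t
  change (1 : SL(2, ℝ)) * rotOneParam _ t * (1 : SL(2, ℝ))⁻¹ = _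
  simp

lemma toSL_zeta : toSL zeta = -1 := by
  rw [zeta_eq_liftClass, toSL_liftClass]
  change rotMatrix (((1 : I) : ℝ) * (2 * Real.pi)) = -1
  ext i j
  fin_cases i <;> fin_cases j <;> simp [rotMatrix]

lemma proj_zeta : proj zeta = 1 := by
  rw [← ofSL_toSL, toSL_zeta, ofSL_neg, map_one]

/-! ### Traces on the regions of the universal cover -/

lemma trace_mul_self (A : SL(2, ℝ)) : (A * A).1.trace = A.1.trace ^ 2 - 2 := by
  rw [Matrix.SpecialLinearGroup.coe_mul, Matrix.trace_fin_two, Matrix.trace_fin_two,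
    Matrix.mul_apply, Matrix.mul_apply, Fin.sum_univ_two, Fin.sum_univ_two]
  linear_combination (-2) * det_eq_one A

lemma mul_self_of_trace_eq_zero {A : SL(2, ℝ)} (h : A.1.trace = 0) : A * A = -1 := by
  rw [Matrix.trace_fin_two] at h
  have hd := det_eq_one A
  have h' : A.1 1 1 = -A.1 0 0 := by linear_combination h
  ext i j
  rw [Matrix.SpecialLinearGroup.coe_mul, Matrix.mul_apply, Fin.sum_univ_two]
  fin_cases i <;> fin_cases j <;> simp [h'] at hd ⊢ <;>
    first | ring1 | linear_combination -hd

lemma isHyperbolic_iff (A : SL(2, ℝ)) : A.1.IsHyperbolic ↔ 4 < A.1.trace ^ 2 := by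
  rw [Matrix.IsHyperbolic, Matrix.discr_fin_two, A.2]
  constructor <;> intro h <;> linarith

lemma isParabolic_iff (A : SL(2, ℝ)) :
    A.1.IsParabolic ↔ A.1.trace ^ 2 = 4 ∧ A ≠ 1 ∧ A ≠ -1 := by
  rw [Matrix.IsParabolic, Matrix.discr_fin_two, A.2, and_comm]
  have h1 : A.1.trace ^ 2 - 4 * 1 = 0 ↔ A.1.trace ^ 2 = 4 := by
    constructor <;> intro h <;> linarith
  rw [h1]
  refine and_congr_right fun ht => ?_
  rw [← not_or, not_iff_not]
  constructor
  · rintro ⟨r, hr⟩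
    have hd := A.2
    rw [← hr] at hd
    have hr' : r = 1 ∨ r = -1 := by simpa using hd
    rcases hr' with rfl | rfl
    · left; ext i j; simp [← hr]
    · right; ext i j
      rw [← hr]
      fin_cases i <;> fin_cases j <;> simp
  · rintro (rfl | rfl)
    · exact ⟨1, by simp⟩
    · refine ⟨-1, ?_⟩
      ext i j
      fin_cases i <;> fin_cases j <;> simp

lemma trace_neg (A : SL(2, ℝ)) : (-A).1.trace = -A.1.trace := by
  simp

lemma isHyperbolic_ofSL_iff (A : SL(2, ℝ)) : IsHyperbolic (ofSL A) ↔ 4 < A.1.trace ^ 2 := by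
  constructor
  · rintro ⟨B, hB, h⟩
    rw [isHyperbolic_iff] at h
    rcases ofSL_eq_iff.1 hB with rfl | rfl
    · exact h
    · rwa [trace_neg, neg_sq] at h
  · exact fun h => ⟨A, rfl, (isHyperbolic_iff A).2 h⟩

lemma isParabolic_ofSL_iff (A : SL(2, ℝ)) :
    IsParabolic (ofSL A) ↔ A.1.trace ^ 2 = 4 ∧ A ≠ 1 ∧ A ≠ -1 := by
  constructor
  · rintro ⟨B, hB, h⟩
    rw [isParabolic_iff] at h
    rcases ofSL_eq_iff.1 hB with rfl | rfl
    · exact h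
    · rwa [trace_neg, neg_sq, Ne, Ne, neg_inj, neg_eq_iff_eq_neg, and_comm (a := ¬ _)] at h
  · exact fun h => ⟨A, rfl, (isParabolic_iff A).2 h⟩

/-- Being hyperbolic fixes the trace only up to sign. The matrix is a square, so its trace is at
least `-2`, which excludes the negative sign. -/
lemma trace_ofOneParam_of_isHyperbolic {c : Multiplicative ℝ →ₜ* PSL(2, ℝ)}
    (h : IsHyperbolic (c (Multiplicative.ofAdd 1))) : 2 < trace (ofOneParam c) := by
  rw [← proj_ofOneParam, ← ofSL_toSL, isHyperbolic_ofSL_iff] at h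
  obtain ⟨y, hy⟩ := exists_mul_self_eq_ofOneParam c
  rw [trace]
  rw [hy, toSL_mul, trace_mul_self] at h ⊢
  nlinarith [sq_nonneg (toSL y).1.trace]

lemma trace_ofOneParam_of_isParabolic {c : Multiplicative ℝ →ₜ* PSL(2, ℝ)}
    (h : IsParabolic (c (Multiplicative.ofAdd 1))) : trace (ofOneParam c) = 2 := by
  rw [← proj_ofOneParam, ← ofSL_toSL, isParabolic_ofSL_iff] at h
  obtain ⟨y, hy⟩ := exists_mul_self_eq_ofOneParam c
  rw [trace]
  rw [hy, toSL_mul, trace_mul_self] at h ⊢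
  -- Trace `-2` would need a square root of trace `0`, whose square is `-1` by Cayley–Hamilton; this
  -- is not parabolic.
  have h0 : (toSL y).1.trace ≠ 0 := fun h0 => h.2.2 (mul_self_of_trace_eq_zero h0)
  have h1 : (toSL y).1.trace ^ 2 * ((toSL y).1.trace ^ 2 - 4) = 0 := by linear_combination h.1
  rcases mul_eq_zero.1 h1 with h2 | h2
  · exact absurd (pow_eq_zero_iff (two_ne_zero)|>.1 h2) h0
  · linarith

lemma toSL_zeta_zpow_mul {n : ℤ} (hn : n = 1 ∨ n = -1) (x : UnivCover PSL(2, ℝ)) :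
    toSL (zeta ^ n * x) = -toSL x := by
  have hz : toSLHom zeta = -1 := toSL_zeta
  have h1 : (-1 : SL(2, ℝ))⁻¹ = -1 := by rw [inv_eq_iff_mul_eq_one]; simp
  rw [toSL_mul, toSL_eq_toSLHom (zeta ^ n), map_zpow, hz]
  rcases hn with rfl | rfl <;> simp [h1]

lemma trace_zeta_zpow_mul {n : ℤ} (hn : n = 1 ∨ n = -1) (x : UnivCover PSL(2, ℝ)) :
    trace (zeta ^ n * x) = -trace x := by
  rw [trace, toSL_zeta_zpow_mul hn, trace_neg, trace]

lemma trace_lt_two_of_mem_Hyp {n : ℤ} (hn : n = 1 ∨ n = -1) {x : UnivCover PSL(2, ℝ)}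
    (h : x ∈ Hyp n) : trace x < 2 := by
  obtain ⟨c, hc, rfl⟩ := h
  rw [trace_zeta_zpow_mul hn]
  linarith [trace_ofOneParam_of_isHyperbolic hc]

lemma trace_lt_two_of_mem_Par {n : ℤ} (hn : n = 1 ∨ n = -1) {x : UnivCover PSL(2, ℝ)}
    (h : x ∈ Par n) : trace x < 2 := by
  obtain ⟨c, hc, rfl⟩ := h
  rw [trace_zeta_zpow_mul hn]
  linarith [trace_ofOneParam_of_isParabolic hc]

lemma trace_conj (g A : SL(2, ℝ)) : (g * A * g⁻¹).1.trace = A.1.trace := by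
  rw [Matrix.SpecialLinearGroup.coe_mul, Matrix.trace_mul_comm,
    ← Matrix.SpecialLinearGroup.coe_mul, ← mul_assoc, inv_mul_cancel, one_mul]

lemma trace_rotation (g : PSL(2, ℝ)) (θ : ℝ) :
    trace (ofOneParam (rotation g θ)) = 2 * Real.cos (θ / 2) := by
  obtain ⟨g, rfl⟩ := ofSL_surjective g
  rw [trace, toSL_rotation, trace_conj, Matrix.trace_fin_two]
  simp [rotMatrix]
  ring

/-- The region of the universal cover that contains the lifts of commutators of hyperbolics with
crossing axes. -/
def crossingRegion : Set (UnivCover PSL(2, ℝ)) :=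
  (EllOne ∪ EllNegOne) ∪ (ParMinus 1 ∪ ParPlus (-1)) ∪ (Hyp 1 ∪ Hyp (-1))

lemma trace_lt_two_of_mem_crossingRegion {x : UnivCover PSL(2, ℝ)} (h : x ∈ crossingRegion) :
    trace x < 2 := by
  rcases h with ((⟨g, θ, hθ, rfl⟩ | ⟨g, θ, hθ, rfl⟩) | (h | h)) | (h | h)
  · rw [trace_rotation]
    have := Real.cos_lt_cos_of_nonneg_of_le_pi le_rfl (by linarith [hθ.2] : θ / 2 ≤ Real.pi)
      (by linarith [hθ.1])
    rw [Real.cos_zero] at this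
    linarith
  · rw [trace_rotation, ← Real.cos_neg]
    have := Real.cos_lt_cos_of_nonneg_of_le_pi le_rfl (by linarith [hθ.1] : -(θ / 2) ≤ Real.pi)
      (by linarith [hθ.2])
    rw [Real.cos_zero] at this
    linarith
  · exact trace_lt_two_of_mem_Par (Or.inl rfl) h.1
  · exact trace_lt_two_of_mem_Par (Or.inr rfl) h.1
  · exact trace_lt_two_of_mem_Hyp (Or.inl rfl) h
  · exact trace_lt_two_of_mem_Hyp (Or.inr rfl) h

/-! ### Normal forms -/

/-- The element of `SL(2, ℝ)` with the given entries. -/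
def mkSL (a b c d : ℝ) (h : a * d - b * c = 1) : SL(2, ℝ) :=
  ⟨!![a, b; c, d], by rw [Matrix.det_fin_two_of, h]⟩

lemma exists_eq_mkSL (A : SL(2, ℝ)) : ∃ a b c d h, A = mkSL a b c d h := by
  refine ⟨A 0 0, A 0 1, A 1 0, A 1 1, det_eq_one A, ?_⟩
  ext i j
  fin_cases i <;> fin_cases j <;> rfl

lemma mkSL_mul {a b c d a' b' c' d' : ℝ} (h : a * d - b * c = 1) (h' : a' * d' - b' * c' = 1) :
    mkSL a b c d h * mkSL a' b' c' d' h' =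
      mkSL (a * a' + b * c') (a * b' + b * d') (c * a' + d * c') (c * b' + d * d')
        (by linear_combination (a' * d' - b' * c') * h + h') := by
  ext i j
  rw [Matrix.SpecialLinearGroup.coe_mul, Matrix.mul_apply, Fin.sum_univ_two]
  fin_cases i <;> fin_cases j <;> simp [mkSL]

lemma mkSL_congr {a b c d a' b' c' d' : ℝ} (h : a * d - b * c = 1) (h' : a' * d' - b' * c' = 1)
    (ha : a = a') (hb : b = b') (hc : c = c') (hd : d = d') : mkSL a b c d h = mkSL a' b' c' d' h' := by
  subst ha hb hc hd; rfl

lemma mkSL_inv {a b c d : ℝ} (h : a * d - b * c = 1) :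
    (mkSL a b c d h)⁻¹ = mkSL d (-b) (-c) a (by linear_combination h) := by
  rw [inv_eq_iff_mul_eq_one, mkSL_mul]
  ext i j
  fin_cases i <;> fin_cases j <;> simp [mkSL] <;> first | ring1 | linear_combination h

@[simp] lemma trace_mkSL {a b c d : ℝ} (h : a * d - b * c = 1) :
    (mkSL a b c d h).1.trace = a + d := by
  rw [Matrix.trace_fin_two]; rfl

@[simp] lemma mkSL_zero_one {a b c d : ℝ} (h : a * d - b * c = 1) : mkSL a b c d h 0 1 = b := rfl
@[simp] lemma mkSL_one_zero {a b c d : ℝ} (h : a * d - b * c = 1) : mkSL a b c d h 1 0 = c := rfl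

lemma rotMatrix_eq (θ : ℝ) : rotMatrix θ = mkSL (Real.cos (θ / 2)) (Real.sin (θ / 2))
    (-Real.sin (θ / 2)) (Real.cos (θ / 2)) (by linarith [Real.sin_sq_add_cos_sq (θ / 2)]) := rfl

lemma transMatrix_eq (t : ℝ) : transMatrix t = mkSL 1 t 0 1 (by norm_num) := rfl

/-- The diagonal matrix with entries `exp l` and `exp (-l)`. -/
def diagMatrix (l : ℝ) : SL(2, ℝ) :=
  mkSL (Real.exp l) 0 0 (Real.exp (-l)) (by rw [← Real.exp_add]; simp)

lemma diagMatrix_add (s t : ℝ) : diagMatrix (s + t) = diagMatrix s * diagMatrix t := by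
  rw [diagMatrix, diagMatrix, diagMatrix, mkSL_mul]
  apply mkSL_congr <;> simp [Real.exp_add, mul_comm]

lemma diagMatrix_log {a d : ℝ} (ha : 0 < a) (h : a * d = 1) :
    diagMatrix (Real.log a) = mkSL a 0 0 d (by linarith) := by
  apply mkSL_congr
  · exact Real.exp_log ha
  · rfl
  · rfl
  · rw [Real.exp_neg, Real.exp_log ha, inv_eq_of_mul_eq_one_right h]

lemma transMatrix_add (s t : ℝ) : transMatrix (s + t) = transMatrix s * transMatrix t := by
  rw [transMatrix_eq, transMatrix_eq, transMatrix_eq, mkSL_mul]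
  apply mkSL_congr <;> ring

lemma continuous_mkSL {X : Type*} [TopologicalSpace X] {a b c d : X → ℝ}
    (h : ∀ x, a x * d x - b x * c x = 1) (ha : Continuous a) (hb : Continuous b)
    (hc : Continuous c) (hd : Continuous d) :
    Continuous fun x => mkSL (a x) (b x) (c x) (d x) (h x) := by
  refine Continuous.subtype_mk ?_ _
  refine continuous_matrix fun i j => ?_
  fin_cases i <;> fin_cases j <;> simpa

lemma continuous_diagMatrix : Continuous diagMatrix :=
  continuous_mkSL _ (by fun_prop) (by fun_prop) (by fun_prop) (by fun_prop)

lemma continuous_transMatrix : Continuous transMatrix :=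
  continuous_mkSL (fun t => (by norm_num : (1 : ℝ) * 1 - t * 0 = 1))
    (by fun_prop) (by fun_prop) (by fun_prop) (by fun_prop)

/-- A matrix of trace greater than `2` is conjugate to a positive diagonal matrix. -/
lemma exists_conj_diagMatrix {A : SL(2, ℝ)} (hA : 2 < A.1.trace) :
    ∃ (g : SL(2, ℝ)) (l : ℝ), l ≠ 0 ∧ A = g * diagMatrix l * g⁻¹ := by
  obtain ⟨a, b, c, d, h, rfl⟩ := exists_eq_mkSL A
  rw [trace_mkSL] at hA
  simp only [eq_mul_inv_iff_mul_eq]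
  by_cases hc : c = 0
  · subst hc
    have had : a * d = 1 := by linarith
    have ha : 0 < a := by
      by_contra ha
      have hd : 0 < d := by linarith
      nlinarith
    have hne : a ≠ d := by
      rintro rfl
      nlinarith
    have hne' : a - d ≠ 0 := sub_ne_zero.2 hne
    -- The columns are eigenvectors for `a` and `d`.
    refine ⟨mkSL 1 (-b / (a - d)) 0 1 (by ring), Real.log a, ?_, ?_⟩
    · intro hl
      rcases Real.log_eq_zero.1 hl with h1 | h1 | h1
      · linarith
      · apply hne; rw [h1] at had ⊢; linarith
      · linarith
    · rw [diagMatrix_log ha had, mkSL_mul, mkSL_mul]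
      apply mkSL_congr <;> field_simp <;> ring
  · set s := √((a + d) ^ 2 - 4)
    have hs : s ^ 2 = (a + d) ^ 2 - 4 := Real.sq_sqrt (by nlinarith)
    have hs0 : 0 < s := Real.sqrt_pos.2 (by nlinarith)
    set μ := (a + d + s) / 2 with hμ
    set ν := (a + d - s) / 2 with hν
    have hμν : μ * ν = 1 := by rw [hμ, hν]; linear_combination -hs / 4
    have hμ0 : 1 < μ := by rw [hμ]; linarith
    have hd : μ - ν ≠ 0 := by rw [hμ, hν]; intro h; linarith
    have hsum : μ + ν = a + d := by rw [hμ, hν]; ring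
    have hμ2 : μ ^ 2 = (a + d) * μ - 1 := by rw [← hsum]; linear_combination -hμν
    have hν2 : ν ^ 2 = (a + d) * ν - 1 := by rw [← hsum]; linear_combination -hμν
    -- The columns are the eigenvectors `(μ - d, c)` and `(ν - d, c)`, the second one scaled to make
    -- the determinant `1`.
    refine ⟨mkSL (μ - d) ((ν - d) / (c * (μ - ν))) c (c / (c * (μ - ν))) (by field_simp; ring),
      Real.log μ, (Real.log_pos hμ0).ne', ?_⟩
    rw [diagMatrix_log (by linarith) hμν, mkSL_mul, mkSL_mul]
    apply mkSL_congr
    · linear_combination -hμ2 - h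
    · field_simp
      linear_combination -hν2 - h
    · ring
    · field_simp
      ring

/-- A matrix of trace `2` that turns clockwise is conjugate to a negative translation. -/
lemma exists_conj_transMatrix {A : SL(2, ℝ)} (hA : A.1.trace = 2) (hA' : A 0 1 - A 1 0 < 0) :
    ∃ (g : SL(2, ℝ)) (t : ℝ), t < 0 ∧ A = g * transMatrix t * g⁻¹ := by
  obtain ⟨a, b, c, d, h, rfl⟩ := exists_eq_mkSL A
  rw [trace_mkSL] at hA
  rw [mkSL_zero_one, mkSL_one_zero] at hA'
  have hd : d = 2 - a := by linarith
  subst hd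
  simp only [eq_mul_inv_iff_mul_eq]
  have hbc : (a - 1) ^ 2 = -(b * c) := by linear_combination -h
  by_cases hb : b = 0
  · subst hb
    have ha : a = 1 := by
      have : a - 1 = 0 := pow_eq_zero_iff two_ne_zero |>.1 (by linarith)
      linarith
    subst ha
    -- A quarter turn of the plane exchanges lower and upper triangular matrices and reverses the
    -- sign of the entry.
    refine ⟨mkSL 0 (-1) 1 0 (by norm_num), -c, by linarith, ?_⟩
    rw [transMatrix_eq, mkSL_mul, mkSL_mul]
    apply mkSL_congr <;> ring
  · have hb' : b < 0 := by
      by_contra hb'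
      have : 0 < b := lt_of_le_of_ne (not_lt.1 hb') (Ne.symm hb)
      nlinarith [sq_nonneg (a - 1)]
    -- The first column is the fixed vector of `A`.
    refine ⟨mkSL 1 0 ((1 - a) / b) 1 (by ring), b, hb', ?_⟩
    rw [transMatrix_eq, mkSL_mul, mkSL_mul]
    apply mkSL_congr
    · field_simp; ring
    · ring
    · field_simp; linear_combination hbc
    · field_simp; ring

/-- A matrix of trace in `(-2, 2)` that turns anticlockwise is conjugate to a rotation. -/
lemma exists_conj_rotMatrix {A : SL(2, ℝ)} (hA : A.1.trace < 2) (hA2 : -2 < A.1.trace)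
    (hA' : 0 < A 0 1 - A 1 0) :
    ∃ g : SL(2, ℝ), ∃ θ ∈ Set.Ioo 0 (2 * Real.pi), A = g * rotMatrix θ * g⁻¹ := by
  obtain ⟨a, b, c, d, h, rfl⟩ := exists_eq_mkSL A
  rw [trace_mkSL] at hA hA2
  rw [mkSL_zero_one, mkSL_one_zero] at hA'
  simp only [eq_mul_inv_iff_mul_eq]
  have hbc : b * c < 0 := by nlinarith [sq_nonneg (a - d)]
  have hc : 0 < -c := by
    by_contra hc
    nlinarith
  have hc0 : c ≠ 0 := by linarith
  set φ := Real.arccos ((a + d) / 2)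
  have hcos : Real.cos φ = (a + d) / 2 := Real.cos_arccos (by linarith) (by linarith)
  have h0 : 0 < φ := Real.arccos_pos.2 (by linarith)
  have hπ : φ < Real.pi := Real.arccos_lt_pi.2 (by linarith)
  have hsin : 0 < Real.sin φ := Real.sin_pos_of_pos_of_lt_pi h0 hπ
  have hsc := Real.sin_sq_add_cos_sq φ
  rw [hcos] at hsc
  set s := Real.sin φ
  set p := √(s / -c) with hp
  have hp0 : 0 < p := Real.sqrt_pos.2 (by positivity)
  have hp2 : p ^ 2 = s / -c := Real.sq_sqrt (by positivity)
  have hp2' : s = -c * p ^ 2 := by rw [hp2]; field_simp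
  have hpp : p * p⁻¹ = 1 := mul_inv_cancel₀ hp0.ne'
  -- This affine map takes `i` to the fixed point of `A`, which has real part `(a - d) / (2c)` and
  -- imaginary part `p² = sin φ / (-c)`. The angle is `2 φ` because `rotMatrix` uses half angles.
  refine ⟨mkSL p ((a - d) / (2 * c * p)) 0 p⁻¹ (by rw [hpp]; ring), 2 * φ,
    ⟨by linarith, by linarith⟩, ?_⟩
  rw [rotMatrix_eq, mkSL_mul, mkSL_mul]
  apply mkSL_congr <;> simp only [mul_div_cancel_left₀ φ (two_ne_zero' ℝ), hcos]
  · change _ = p * ((a + d) / 2) + _ * -s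
    rw [hp2']
    field_simp
    ring
  · change _ = p * s + _
    have : a * ((a - d) / (2 * c * p)) + b * p⁻¹ - (p * s + (a - d) / (2 * c * p) * ((a + d) / 2))
        = ((a - d) ^ 2 / 4 + b * c - c * p ^ 2 * s) / (c * p) := by
      field_simp
      ring
    rw [← sub_eq_zero, this]
    have : (a - d) ^ 2 / 4 + b * c - c * p ^ 2 * s = 0 := by
      linear_combination hsc - h - s * hp2'
    rw [this, zero_div]
  · change _ = 0 * ((a + d) / 2) + p⁻¹ * -s
    rw [hp2']
    field_simp
    ring
  · change _ = 0 * s + _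
    field_simp
    ring

/-! ### Recognising the classes of paths that turn anticlockwise -/

lemma linPart_mem_slitPlane {M : SL(2, ℝ)} (h : M 0 1 - M 1 0 ≠ 0) :
    linPart M ∈ Complex.slitPlane :=
  Complex.mem_slitPlane_iff.2 (Or.inr (div_ne_zero h two_ne_zero))

lemma linPart_mem_slitPlane_of_trace_pos {M : SL(2, ℝ)} (h : 0 < M.1.trace) :
    linPart M ∈ Complex.slitPlane := by
  rw [Matrix.trace_fin_two] at h
  exact Complex.mem_slitPlane_iff.2 (Or.inl (half_pos h))

lemma linPart_rotMatrix_mul (θ : ℝ) (M : SL(2, ℝ)) :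
    linPart (rotMatrix θ * M) = Complex.exp ((θ / 2 : ℝ) * Complex.I) * linPart M := by
  obtain ⟨a, b, c, d, h, rfl⟩ := exists_eq_mkSL M
  rw [rotMatrix_eq, mkSL_mul]
  apply Complex.ext
  · rw [Complex.mul_re, Complex.exp_ofReal_mul_I_re, Complex.exp_ofReal_mul_I_im]
    simp [linPart, mkSL]
    ring
  · rw [Complex.mul_im, Complex.exp_ofReal_mul_I_re, Complex.exp_ofReal_mul_I_im]
    simp [linPart, mkSL]
    ring

/-- The classes of based paths that can be chosen to turn anticlockwise, with endpoint of trace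
less than `2`. -/
def positiveRegion : Set (UnivCover PSL(2, ℝ)) := EllOne ∪ ParMinus 1 ∪ Hyp 1

/-- The difference of the off-diagonal entries is twice the imaginary part of `linPart`, so its sign
tells the half-plane that contains the linear part. The formula shows that conjugating a rotation
preserves this sign. -/
lemma turning_conj_rotMatrix (g : SL(2, ℝ)) (θ : ℝ) :
    (g * rotMatrix θ * g⁻¹) 0 1 - (g * rotMatrix θ * g⁻¹) 1 0 =
      Real.sin (θ / 2) * (g 0 0 ^ 2 + g 0 1 ^ 2 + g 1 0 ^ 2 + g 1 1 ^ 2) := by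
  obtain ⟨a, b, c, d, h, rfl⟩ := exists_eq_mkSL g
  rw [rotMatrix_eq, mkSL_mul, mkSL_inv, mkSL_mul]
  simp [mkSL]
  ring

lemma sq_entries_pos (g : SL(2, ℝ)) : 0 < g 0 0 ^ 2 + g 0 1 ^ 2 + g 1 0 ^ 2 + g 1 1 ^ 2 := by
  nlinarith [det_eq_one g, sq_nonneg (g 0 0 - g 1 1), sq_nonneg (g 0 1 + g 1 0)]

/-- A based path turning anticlockwise throughout has an angle function, given by the principal
argument. -/
lemma exists_isAngle_of_turning {γ : BasedPaths SL(2, ℝ)}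
    (h : ∀ t, t ≠ 0 → 0 < γ.1 t 0 1 - γ.1 t 1 0) :
    ∃ θ : C(I, ℝ), IsAngle γ θ ∧ ∀ t, θ t = Complex.arg (linPart (γ.1 t)) := by
  refine exists_isAngle_arg γ fun t => ?_
  by_cases ht : t = 0
  · subst ht
    have h0 : γ.1 0 = 1 := γ.2
    rw [h0]
    exact linPart_mem_slitPlane_of_trace_pos (by simp)
  · exact linPart_mem_slitPlane (h t ht).ne'

/-- Both linear parts stay in the open upper half-plane after time `0`, so both angles are principal
arguments and are determined by the endpoint. -/
lemma liftClass_eq_of_turning {γ δ : BasedPaths SL(2, ℝ)}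
    (hγ : ∀ t, t ≠ 0 → 0 < γ.1 t 0 1 - γ.1 t 1 0) (hδ : ∀ t, t ≠ 0 → 0 < δ.1 t 0 1 - δ.1 t 1 0)
    (h : γ.1 1 = δ.1 1) : liftClass γ = liftClass δ := by
  obtain ⟨θ, hθ, hθ'⟩ := exists_isAngle_of_turning hγ
  obtain ⟨φ, hφ, hφ'⟩ := exists_isAngle_of_turning hδ
  exact liftClass_eq_of_isAngle hθ hφ h (by rw [hθ', hφ', h])

/-- A path turning anticlockwise to `-c(1)`, for a one-parameter subgroup `c` of matrices of
positive trace, represents `zeta` times the class of `c`. -/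
lemma liftClass_eq_zeta_mul {γ : BasedPaths SL(2, ℝ)}
    (hγ : ∀ t, t ≠ 0 → 0 < γ.1 t 0 1 - γ.1 t 1 0) {c : Multiplicative ℝ →ₜ* SL(2, ℝ)}
    (hc : ∀ t, 0 < (c t).1.trace) (h : γ.1 1 = -c (Multiplicative.ofAdd 1)) :
    liftClass γ = zeta * ofOneParam (projOneParam c) := by
  obtain ⟨θ, hθ, hθ'⟩ := exists_isAngle_of_turning hγ
  obtain ⟨φ, hφ, hφ'⟩ := exists_isAngle_arg (oneParamPath c) fun t =>
    linPart_mem_slitPlane_of_trace_pos (hc _)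
  have hc1 : (oneParamPath c).1 1 = c (Multiplicative.ofAdd 1) := by
    change c (Multiplicative.ofAdd ((1 : I) : ℝ)) = _
    simp
  rw [zeta_eq_liftClass, ofOneParam_projOneParam, ← map_mul]
  have hval : ∀ t : I, (oneParamPath (rotOneParam (2 * Real.pi)) * oneParamPath c).1 t =
      rotMatrix ((t : ℝ) * (2 * Real.pi)) * (oneParamPath c).1 t := fun t => rfl
  -- The full turn contributes `t π` to the angle: a rotation through `2π` about a point turns
  -- vectors of `ℝ²` through `π`.
  refine liftClass_eq_of_isAngle hθ
    (φ := ⟨fun t => (t : ℝ) * Real.pi + φ t, by fun_prop⟩) ⟨?_, fun t => ?_⟩ ?_ ?_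
  · change ((0 : I) : ℝ) * Real.pi + φ 0 = 0
    rw [hφ.1]
    simp
  · rw [hval, linPart_rotMatrix_mul, norm_mul, Complex.norm_exp_ofReal_mul_I, one_mul, hφ.2 t]
    have e : (t : ℝ) * (2 * Real.pi) / 2 = (t : ℝ) * Real.pi := by ring
    have hn : ‖((‖linPart ((oneParamPath c).1 t)‖ : ℝ) : ℂ) * Complex.exp (φ t * Complex.I)‖ =
        ‖linPart ((oneParamPath c).1 t)‖ := by
      rw [norm_mul, Complex.norm_exp_ofReal_mul_I, mul_one, Complex.norm_real, norm_norm]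
    rw [hn, e]
    change _ = _ * Complex.exp (((t : ℝ) * Real.pi + φ t : ℝ) * Complex.I)
    rw [Complex.ofReal_add, add_mul, Complex.exp_add]
    exact mul_left_comm _ _ _
  · rw [hval, hc1, h]
    have : rotMatrix (((1 : I) : ℝ) * (2 * Real.pi)) = -1 := by
      ext i j
      fin_cases i <;> fin_cases j <;> simp [rotMatrix]
    rw [this, neg_one_mul]
  · change _ = ((1 : I) : ℝ) * Real.pi + φ 1
    have hneg : linPart (γ.1 1) = -linPart (c (Multiplicative.ofAdd 1)) := by
      rw [h]
      apply Complex.ext <;> simp [linPart] <;> ring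
    have him : (linPart (c (Multiplicative.ofAdd 1))).im < 0 := by
      have := half_pos (hγ 1 one_ne_zero)
      have h2 : 0 < (linPart (γ.1 1)).im := this
      rw [hneg, Complex.neg_im] at h2
      linarith
    -- With `w` the linear part of `c(1)`, `Im w < 0` gives `arg (-w) = arg w + π`. This is what
    -- makes the power of `zeta` exactly one.
    rw [hθ', hφ', hc1, hneg, Complex.arg_neg_eq_arg_add_pi_of_im_neg him]
    simp
    ring

/-- The endpoint, or its negative when the trace is at most `-2`, lies on a one-parameter group in
normal form. The class of `γ` is then that of the rotation path, or `zeta` times that of the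
one-parameter path. In the parabolic case the negated endpoint turns clockwise, hence the minus in
`ParMinus 1`. -/
theorem liftClass_mem_positiveRegion {γ : BasedPaths SL(2, ℝ)}
    (hγ : ∀ t, t ≠ 0 → 0 < γ.1 t 0 1 - γ.1 t 1 0) (htr : (γ.1 1).1.trace < 2) :
    liftClass γ ∈ positiveRegion := by
  have h1 := hγ 1 one_ne_zero
  have hneg : (-γ.1 1) 0 1 - (-γ.1 1) 1 0 < 0 := by
    simp only [Matrix.SpecialLinearGroup.coe_neg, Matrix.neg_apply]
    linarith
  rcases lt_trichotomy (-2) (γ.1 1).1.trace with ht | ht | ht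
  · obtain ⟨g, θ, hθ, hg⟩ := exists_conj_rotMatrix htr ht h1
    refine Or.inl (Or.inl ⟨ofSL g, θ, hθ, ?_⟩)
    rw [rotation_ofSL, ofOneParam_projOneParam]
    refine liftClass_eq_of_turning hγ (fun t ht0 => ?_) ?_
    · change 0 < (g * rotMatrix ((t : ℝ) * θ) * g⁻¹) 0 1 - (g * rotMatrix ((t : ℝ) * θ) * g⁻¹) 1 0
      rw [turning_conj_rotMatrix]
      have ht1 : 0 < (t : ℝ) := unitInterval.pos_iff_ne_zero.2 ht0
      have ht2 : (t : ℝ) ≤ 1 := t.2.2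
      have hθ1 := hθ.1
      have hθ2 := hθ.2
      refine mul_pos (Real.sin_pos_of_pos_of_lt_pi (by positivity) ?_) (sq_entries_pos g)
      nlinarith
    · rw [hg]
      change _ = g * rotMatrix (((1 : I) : ℝ) * θ) * g⁻¹
      simp
  · obtain ⟨g, t, ht0, hg⟩ := exists_conj_transMatrix (A := -γ.1 1)
      (by rw [trace_neg]; linarith) hneg
    set c := conjOneParam g (oneParamOfAdd (fun s => transMatrix (s * t))
      (continuous_transMatrix.comp (by fun_prop)) fun s s' => by rw [add_mul, transMatrix_add])
    have hc1 : c (Multiplicative.ofAdd 1) = -γ.1 1 := by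
      rw [hg]
      change g * transMatrix (1 * t) * g⁻¹ = _
      rw [one_mul]
    have key := liftClass_eq_zeta_mul hγ (c := c) (fun s => by
      change 0 < (g * transMatrix (s.toAdd * t) * g⁻¹).1.trace
      rw [trace_conj, transMatrix_eq, trace_mkSL]
      norm_num) (by rw [hc1, neg_neg])
    refine Or.inl (Or.inr ⟨⟨projOneParam c, ?_, by rw [zpow_one, key]⟩, ?_⟩)
    · rw [projOneParam_apply, hc1, isParabolic_ofSL_iff, trace_neg, ← ht]
      refine ⟨by norm_num, fun h => ?_, fun h => ?_⟩ <;> rw [h] at hneg <;> simp at hneg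
    · rw [proj_liftClass, ← ofSL_neg, hg]
      exact ⟨ofSL g, t, ht0, by simp⟩
  · obtain ⟨g, l, -, hg⟩ := exists_conj_diagMatrix (A := -γ.1 1) (by rw [trace_neg]; linarith)
    set c := conjOneParam g (oneParamOfAdd (fun s => diagMatrix (s * l))
      (continuous_diagMatrix.comp (by fun_prop)) fun s s' => by rw [add_mul, diagMatrix_add])
    have hc1 : c (Multiplicative.ofAdd 1) = -γ.1 1 := by
      rw [hg]
      change g * diagMatrix (1 * l) * g⁻¹ = _
      rw [one_mul]
    have key := liftClass_eq_zeta_mul hγ (c := c) (fun s => by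
      change 0 < (g * diagMatrix (s.toAdd * l) * g⁻¹).1.trace
      rw [trace_conj, diagMatrix, trace_mkSL]
      positivity) (by rw [hc1, neg_neg])
    refine Or.inr ⟨projOneParam c, ?_, by rw [zpow_one, key]⟩
    rw [projOneParam_apply, hc1, isHyperbolic_ofSL_iff, trace_neg]
    nlinarith

/-! ### Conjugation and inversion of the regions -/

lemma isHyperbolic_conj {α : PSL(2, ℝ)} (g : PSL(2, ℝ)) (h : IsHyperbolic α) :
    IsHyperbolic (g * α * g⁻¹) := by
  obtain ⟨g, rfl⟩ := ofSL_surjective g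
  obtain ⟨A, rfl⟩ := ofSL_surjective α
  rw [← map_inv, ← map_mul, ← map_mul]
  rw [isHyperbolic_ofSL_iff] at h ⊢
  rwa [trace_conj]

lemma isParabolic_conj {α : PSL(2, ℝ)} (g : PSL(2, ℝ)) (h : IsParabolic α) :
    IsParabolic (g * α * g⁻¹) := by
  obtain ⟨g, rfl⟩ := ofSL_surjective g
  obtain ⟨A, rfl⟩ := ofSL_surjective α
  rw [← map_inv, ← map_mul, ← map_mul]
  rw [isParabolic_ofSL_iff] at h ⊢
  rw [trace_conj, Ne, Ne, mul_inv_eq_iff_eq_mul, mul_inv_eq_iff_eq_mul, one_mul, neg_one_mul,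
    ← mul_neg_one, mul_right_inj, mul_eq_left]
  exact h

lemma trace_inv (A : SL(2, ℝ)) : (A⁻¹).1.trace = A.1.trace := by
  obtain ⟨a, b, c, d, h, rfl⟩ := exists_eq_mkSL A
  rw [mkSL_inv, trace_mkSL, trace_mkSL, add_comm]

lemma isHyperbolic_inv {α : PSL(2, ℝ)} (h : IsHyperbolic α) : IsHyperbolic α⁻¹ := by
  obtain ⟨A, rfl⟩ := ofSL_surjective α
  rw [← map_inv]
  rw [isHyperbolic_ofSL_iff] at h ⊢
  rwa [trace_inv]

lemma isParabolic_inv {α : PSL(2, ℝ)} (h : IsParabolic α) : IsParabolic α⁻¹ := by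
  obtain ⟨A, rfl⟩ := ofSL_surjective α
  have h1 : (-1 : SL(2, ℝ))⁻¹ = -1 := by rw [inv_eq_iff_mul_eq_one]; simp
  rw [← map_inv]
  rw [isParabolic_ofSL_iff] at h ⊢
  rw [trace_inv, Ne, Ne, inv_eq_one, inv_eq_iff_eq_inv, h1]
  exact h

lemma conj_zeta_mul (x y : UnivCover PSL(2, ℝ)) :
    x * (zeta * y) * x⁻¹ = zeta * (x * y * x⁻¹) := by
  rw [← mul_assoc, ← mul_comm_of_proj_eq_one proj_zeta x]
  simp only [mul_assoc]

lemma conj_mem_positiveRegion (x : UnivCover PSL(2, ℝ)) {y : UnivCover PSL(2, ℝ)}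
    (h : y ∈ positiveRegion) : x * y * x⁻¹ ∈ positiveRegion := by
  rcases h with (⟨g, θ, hθ, rfl⟩ | ⟨⟨c, hc, rfl⟩, g, t, ht, hg⟩) | ⟨c, hc, rfl⟩
  · refine Or.inl (Or.inl ⟨proj x * g, θ, hθ, ?_⟩)
    rw [conj_ofOneParam]
    congr 1
    ext t
    change proj x * (g * _ * g⁻¹) * (proj x)⁻¹ = proj x * g * _ * (proj x * g)⁻¹
    group
  · refine Or.inl (Or.inr ⟨⟨conjOneParam (proj x) c, isParabolic_conj _ hc, ?_⟩,
      proj x * g, t, ht, ?_⟩)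
    · rw [zpow_one, conj_zeta_mul, conj_ofOneParam]
    · rw [map_mul, map_mul, hg, map_inv]
      group
  · refine Or.inr ⟨conjOneParam (proj x) c, isHyperbolic_conj _ hc, ?_⟩
    rw [zpow_one, conj_zeta_mul, conj_ofOneParam]

lemma inv_zeta_mul (y : UnivCover PSL(2, ℝ)) : (zeta * y)⁻¹ = zeta ^ (-1 : ℤ) * y⁻¹ := by
  rw [mul_comm_of_proj_eq_one proj_zeta, mul_inv_rev, zpow_neg_one]

lemma transMatrix_neg (t : ℝ) : transMatrix (-t) = (transMatrix t)⁻¹ := by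
  rw [transMatrix_eq, transMatrix_eq, mkSL_inv]
  simp

lemma positiveRegion_subset : positiveRegion ⊆ crossingRegion := by
  rintro x ((h | h) | h)
  · exact Or.inl (Or.inl (Or.inl h))
  · exact Or.inl (Or.inr (Or.inl h))
  · exact Or.inr (Or.inl h)

/-- Inversion reverses the angle, the direction of a parabolic and the power of `zeta`, so it yields
the clockwise half of the crossing region. -/
lemma inv_mem_crossingRegion {y : UnivCover PSL(2, ℝ)} (h : y ∈ positiveRegion) :
    y⁻¹ ∈ crossingRegion := by
  rcases h with (⟨g, θ, hθ, rfl⟩ | ⟨⟨c, hc, rfl⟩, g, t, ht, hg⟩) | ⟨c, hc, rfl⟩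
  · refine Or.inl (Or.inl (Or.inr ⟨g, -θ, ⟨by linarith [hθ.2], by linarith [hθ.1]⟩, ?_⟩))
    rw [inv_ofOneParam]
    congr 1
    ext t
    change g * ofSL (rotMatrix (-t.toAdd * θ)) * g⁻¹ = g * ofSL (rotMatrix (t.toAdd * -θ)) * g⁻¹
    rw [neg_mul, mul_neg]
  · refine Or.inl (Or.inr (Or.inr ⟨⟨invOneParam c, ?_, ?_⟩, g, -t, by linarith, ?_⟩))
    · change IsParabolic (c (Multiplicative.ofAdd 1)⁻¹)
      rw [map_inv]
      exact isParabolic_inv hc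
    · rw [zpow_one, inv_zeta_mul, inv_ofOneParam]
    · rw [map_inv, hg, transMatrix_neg, map_inv]
      group
  · refine Or.inr (Or.inr ⟨invOneParam c, ?_, ?_⟩)
    · change IsHyperbolic (c (Multiplicative.ofAdd 1)⁻¹)
      rw [map_inv]
      exact isHyperbolic_inv hc
    · rw [zpow_one, inv_zeta_mul, inv_ofOneParam]

/-! ### Commutators of trace less than `2` -/

/-- For the traceless parts `A₀`, `B₀`, the bracket is `tr(A₀B₀)² - tr(A₀²) tr(B₀²)`. -/
lemma trace_commutator_mkSL {a b c d e f g h : ℝ} (h₁ : a * d - b * c = 1)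
    (h₂ : e * h - f * g = 1) :
    (⁅mkSL a b c d h₁, mkSL e f g h h₂⁆ : SL(2, ℝ)).1.trace = 2 +
      (((a - d) * (e - h) / 2 + b * g + c * f) ^ 2 -
        4 * (((a - d) / 2) ^ 2 + b * c) * (((e - h) / 2) ^ 2 + f * g)) := by
  rw [commutatorElement_def, mkSL_inv, mkSL_inv, mkSL_mul, mkSL_mul, mkSL_mul, trace_mkSL]
  linear_combination 2 * (e * h - f * g) * h₁ + 2 * h₂

/-- If the traceless part `A₀` has `q = tr(A₀²)/2 ≤ 0`, trace below `2` forces `q < 0` and makes the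
form definite, hence negative, on the span of `A₀` and `B₀`. But `c B₀ - g A₀` is upper triangular,
and the form takes the value `(c y - g x)² ≥ 0` on it. -/
lemma trace_sq_of_trace_commutator_lt_two {A B : SL(2, ℝ)}
    (h : (⁅A, B⁆ : SL(2, ℝ)).1.trace < 2) : 4 < A.1.trace ^ 2 := by
  obtain ⟨a, b, c, d, h₁, rfl⟩ := exists_eq_mkSL A
  obtain ⟨e, f, g, k, h₂, rfl⟩ := exists_eq_mkSL B
  rw [trace_commutator_mkSL] at h
  rw [trace_mkSL]
  by_contra hle
  set x := (a - d) / 2 with hx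
  set y := (e - k) / 2 with hy
  have hP : (a - d) * (e - k) / 2 = 2 * x * y := by rw [hx, hy]; ring
  rw [hP] at h
  set P := 2 * x * y + b * g + c * f with hPdef
  set q := x ^ 2 + b * c with hq
  set r := y ^ 2 + f * g with hr
  have hq0 : q ≤ 0 := by
    have : 4 * q = (a + d) ^ 2 - 4 := by rw [hq, hx]; linear_combination (-4) * h₁
    linarith
  have hqr : 0 < q * r := by nlinarith [sq_nonneg P]
  have hq1 : q < 0 := lt_of_le_of_ne hq0 fun h0 => by rw [h0] at hqr; linarith
  have hc : 0 < c ^ 2 := by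
    refine lt_of_le_of_ne (sq_nonneg c) fun h0 => ?_
    have : c = 0 := pow_eq_zero_iff two_ne_zero |>.1 h0.symm
    rw [hq, this] at hq1
    nlinarith [sq_nonneg x]
  -- The form on `c B₀ - g A₀`, multiplied by `4 q` and completed to a square: the left side is at
  -- most `0` and the right side is positive.
  have key : 4 * q * (g * x - c * y) ^ 2 = (2 * g * q - c * P) ^ 2 + c ^ 2 * (4 * q * r - P ^ 2) := by
    rw [hPdef, hq, hr]; ring
  nlinarith [sq_nonneg (2 * g * q - c * P), sq_nonneg (g * x - c * y),
    mul_pos hc (by linarith : 0 < 4 * q * r - P ^ 2),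
    mul_nonneg (by linarith : 0 ≤ -q) (sq_nonneg (g * x - c * y))]

lemma trace_commutator_comm (A B : SL(2, ℝ)) :
    (⁅A, B⁆ : SL(2, ℝ)).1.trace = (⁅B, A⁆ : SL(2, ℝ)).1.trace := by
  rw [← trace_inv, commutatorElement_inv]

lemma trace_commutator_diagMatrix (l : ℝ) (B : SL(2, ℝ)) :
    (⁅diagMatrix l, B⁆ : SL(2, ℝ)).1.trace =
      2 - (Real.exp l - Real.exp (-l)) ^ 2 * (B 0 1 * B 1 0) := by
  obtain ⟨a, b, c, d, h, rfl⟩ := exists_eq_mkSL B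
  rw [diagMatrix, trace_commutator_mkSL, mkSL_zero_one, mkSL_one_zero]
  ring

lemma exp_sub_exp_neg_ne_zero {l : ℝ} (hl : l ≠ 0) : Real.exp l - Real.exp (-l) ≠ 0 := by
  rw [sub_ne_zero, Ne, Real.exp_eq_exp]
  intro h
  exact hl (by linarith)

lemma trace_commutator_diagMatrix_lt_two_iff {l : ℝ} (hl : l ≠ 0) (B : SL(2, ℝ)) :
    (⁅diagMatrix l, B⁆ : SL(2, ℝ)).1.trace < 2 ↔ 0 < B 0 1 * B 1 0 := by
  have := pow_pos (abs_pos.2 (exp_sub_exp_neg_ne_zero hl)) 2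
  rw [sq_abs] at this
  rw [trace_commutator_diagMatrix, sub_lt_self_iff, mul_pos_iff_of_pos_left this]

/-! ### The direction of turning of a commutator path -/

lemma mul_exp_sub_exp_neg_pos {u : ℝ} (hu : u ≠ 0) : 0 < u * (Real.exp u - Real.exp (-u)) := by
  rcases lt_or_gt_of_ne hu with h | h
  · exact mul_pos_of_neg_of_neg h (sub_neg.2 (Real.exp_lt_exp.2 (by linarith)))
  · exact mul_pos h (sub_pos.2 (Real.exp_lt_exp.2 (by linarith)))

lemma turning_inv (A : SL(2, ℝ)) : (A⁻¹) 0 1 - (A⁻¹) 1 0 = -(A 0 1 - A 1 0) := by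
  obtain ⟨a, b, c, d, h, rfl⟩ := exists_eq_mkSL A
  rw [mkSL_inv]
  simp
  ring

lemma conj_diagMatrix {p q r s : ℝ} (h : p * s - q * r = 1) (v : ℝ) :
    mkSL p q r s h * diagMatrix v * (mkSL p q r s h)⁻¹ =
      mkSL (p * s * Real.exp v - q * r * Real.exp (-v)) (-(p * q) * (Real.exp v - Real.exp (-v)))
        (r * s * (Real.exp v - Real.exp (-v))) (p * s * Real.exp (-v) - q * r * Real.exp v)
        (by
          have : Real.exp v * Real.exp (-v) = 1 := by rw [← Real.exp_add]; simp
          linear_combination (p * s - q * r) ^ 2 * this + (p * s - q * r + 1) * h) := by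
  rw [diagMatrix, mkSL_inv, mkSL_mul, mkSL_mul]
  apply mkSL_congr <;> ring

/-- The commutators of two one-parameter groups of hyperbolics with crossing axes keep turning in
the same direction. -/
lemma turning_commutator {p q r s : ℝ} (h : p * s - q * r = 1) (hps : 0 < p * s) (hqr : q * r < 0)
    {u v : ℝ} (hu : u ≠ 0) (hv : v ≠ 0) :
    0 < -(p * q) * (u * v) *
      (⁅diagMatrix u, mkSL p q r s h * diagMatrix v * (mkSL p q r s h)⁻¹⁆ 0 1 -
        ⁅diagMatrix u, mkSL p q r s h * diagMatrix v * (mkSL p q r s h)⁻¹⁆ 1 0) := by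
  have hU := mul_exp_sub_exp_neg_pos hu
  have hV := mul_exp_sub_exp_neg_pos hv
  have hu1 := Real.exp_pos u
  have hu2 := Real.exp_pos (-u)
  have hv1 := Real.exp_pos v
  have hv2 := Real.exp_pos (-v)
  rw [conj_diagMatrix, commutatorElement_def, diagMatrix, mkSL_inv, mkSL_inv, mkSL_mul, mkSL_mul,
    mkSL_mul, mkSL_zero_one, mkSL_one_zero]
  set x := Real.exp u
  set x' := Real.exp (-u)
  set y := Real.exp v
  set y' := Real.exp (-v)
  have hA : 0 < p * s * y - q * r * y' := by nlinarith
  have hD : 0 < p * s * y' - q * r * y := by nlinarith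
  have hpq : 0 < (p * q) ^ 2 := by
    have h1 : p ≠ 0 := by rintro rfl; simp at hps
    have h2 : q ≠ 0 := by rintro rfl; simp at hqr
    positivity
  have hpqrs : 0 < -(p * q) * (r * s) := by nlinarith [mul_pos hps (neg_pos.2 hqr)]
  -- The turning factors as `(x - x')(y - y')` times a sum that, after multiplication by `-(p q)`,
  -- has positive terms because `p s` and `q r` have opposite signs.
  have key : 0 < (u * (x - x')) * (v * (y - y')) *
      (x * (p * s * y - q * r * y') * (p * q) ^ 2 +
        x' * (p * s * y' - q * r * y) * (-(p * q) * (r * s))) := by positivity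
  refine key.trans_eq ?_
  ring

/-- The one-parameter subgroup of translations along the imaginary axis. -/
def diagOneParam (l : ℝ) : Multiplicative ℝ →ₜ* SL(2, ℝ) :=
  oneParamOfAdd (fun s => diagMatrix (s * l)) (continuous_diagMatrix.comp (by fun_prop))
    fun s s' => by rw [add_mul, diagMatrix_add]

lemma commutatorLift_diagMatrix_mem {l : ℝ} (hl : l ≠ 0) {B : SL(2, ℝ)} (hB : 2 < B.1.trace)
    (h : 0 < B 0 1 * B 1 0) :
    commutatorLift (ofSL (diagMatrix l)) (ofSL B) ∈ positiveRegion ∨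
      (commutatorLift (ofSL (diagMatrix l)) (ofSL B))⁻¹ ∈ positiveRegion := by
  have htr := (trace_commutator_diagMatrix_lt_two_iff hl B).2 h
  obtain ⟨g, m, hm, rfl⟩ := exists_conj_diagMatrix hB
  obtain ⟨p, q, r, s, hg, rfl⟩ := exists_eq_mkSL g
  -- The product of the off-diagonal entries is `-(p q r s)(exp m - exp (-m))²`. Since `p s - q r =
  -- 1`, the sign found here puts `p s` strictly between `0` and `1`.
  have hpqrs : p * s * (q * r) < 0 := by
    rw [conj_diagMatrix, mkSL_zero_one, mkSL_one_zero] at h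
    nlinarith [sq_nonneg (Real.exp m - Real.exp (-m))]
  have hps : 0 < p * s := by nlinarith [sq_nonneg (p * s)]
  have hqr : q * r < 0 := by nlinarith
  set g := mkSL p q r s hg
  set γ := oneParamPath (diagOneParam l)
  set δ := oneParamPath (conjOneParam g (diagOneParam m))
  have hγ : ∀ t, γ.1 t = diagMatrix ((t : ℝ) * l) := fun t => rfl
  have hδ : ∀ t, δ.1 t = g * diagMatrix ((t : ℝ) * m) * g⁻¹ := fun t => rfl
  have hval : ∀ t, (⁅γ, δ⁆ : BasedPaths SL(2, ℝ)).1 t = ⁅γ.1 t, δ.1 t⁆ := fun t => rfl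
  have hα : ofSL (diagMatrix l) = proj (liftClass γ) := by
    rw [proj_liftClass, hγ, Set.Icc.coe_one, one_mul]
  have hβ : ofSL (g * diagMatrix m * g⁻¹) = proj (liftClass δ) := by
    rw [proj_liftClass, hδ, Set.Icc.coe_one, one_mul]
  have hturn : ∀ t : I, t ≠ 0 → 0 < -(p * q) * (l * m) *
      ((⁅γ, δ⁆ : BasedPaths SL(2, ℝ)).1 t 0 1 - (⁅γ, δ⁆ : BasedPaths SL(2, ℝ)).1 t 1 0) := by
    intro t ht
    have ht1 : 0 < (t : ℝ) := unitInterval.pos_iff_ne_zero.2 ht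
    have := turning_commutator hg hps hqr (mul_ne_zero ht1.ne' hl) (mul_ne_zero ht1.ne' hm)
    rw [hval, hγ, hδ]
    -- At time `t` the lengths are `t l` and `t m`; their product has the sign of `l m` for every `t
    -- ≠ 0`, so the direction of turning is constant.
    refine pos_of_mul_pos_right (a := (t : ℝ) ^ 2) (this.trans_eq ?_) (by positivity)
    ring
  have hend : ((⁅γ, δ⁆ : BasedPaths SL(2, ℝ)).1 1).1.trace < 2 := by
    rw [hval, hγ, hδ, Set.Icc.coe_one, one_mul, one_mul]
    exact htr
  rw [hα, hβ, commutatorLift_eq, ← map_commutatorElement, ← map_inv]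
  have hK : -(p * q) * (l * m) ≠ 0 := fun h0 => by
    have := hturn 1 one_ne_zero
    rw [h0, zero_mul] at this
    exact this.false
  rcases lt_or_gt_of_ne hK with hK | hK
  · right
    have hinv : ∀ t, (⁅γ, δ⁆⁻¹ : BasedPaths SL(2, ℝ)).1 t =
      ((⁅γ, δ⁆ : BasedPaths SL(2, ℝ)).1 t)⁻¹ := fun t => rfl
    refine liftClass_mem_positiveRegion (fun t ht => ?_) ?_
    · rw [hinv, turning_inv]
      have := hturn t ht
      exact neg_pos.2 (neg_of_mul_pos_right this hK.le)
    · rw [hinv, trace_inv]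
      exact hend
  · left
    exact liftClass_mem_positiveRegion
      (fun t ht => pos_of_mul_pos_right (hturn t ht) hK.le) hend

/-! ### Reduction of a pair to normal form -/

lemma exists_ofSL_eq_two_lt_trace {α : PSL(2, ℝ)} (h : IsHyperbolic α) :
    ∃ A : SL(2, ℝ), ofSL A = α ∧ 2 < A.1.trace := by
  obtain ⟨A, rfl⟩ := ofSL_surjective α
  rw [isHyperbolic_ofSL_iff] at h
  rcases le_or_gt 0 A.1.trace with h0 | h0
  · exact ⟨A, rfl, by nlinarith⟩
  · exact ⟨-A, ofSL_neg A, by rw [trace_neg]; nlinarith⟩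

lemma isHyperbolic_of_trace_commutatorLift {α β : PSL(2, ℝ)}
    (h : trace (commutatorLift α β) < 2) : IsHyperbolic α ∧ IsHyperbolic β := by
  obtain ⟨A, rfl⟩ := ofSL_surjective α
  obtain ⟨B, rfl⟩ := ofSL_surjective β
  rw [trace_commutatorLift] at h
  rw [isHyperbolic_ofSL_iff, isHyperbolic_ofSL_iff]
  exact ⟨trace_sq_of_trace_commutator_lt_two h,
    trace_sq_of_trace_commutator_lt_two (by rwa [trace_commutator_comm])⟩

/-- A pair of hyperbolics is simultaneously conjugate to a pair whose first member translates along
the imaginary axis. -/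
lemma exists_conj_pair {α β : PSL(2, ℝ)} (hα : IsHyperbolic α) (hβ : IsHyperbolic β) :
    ∃ (g : PSL(2, ℝ)) (l : ℝ) (B : SL(2, ℝ)), l ≠ 0 ∧ 2 < B.1.trace ∧
      α = g * ofSL (diagMatrix l) * g⁻¹ ∧ β = g * ofSL B * g⁻¹ := by
  obtain ⟨A, rfl, hA⟩ := exists_ofSL_eq_two_lt_trace hα
  obtain ⟨B, rfl, hB⟩ := exists_ofSL_eq_two_lt_trace hβ
  obtain ⟨g, l, hl, rfl⟩ := exists_conj_diagMatrix hA
  refine ⟨ofSL g, l, g⁻¹ * B * g, hl, ?_, by simp, ?_⟩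
  · have := trace_conj g⁻¹ B
    rw [inv_inv] at this
    rwa [this]
  · simp only [map_mul, map_inv]
    group

lemma commutatorLift_conj (x : UnivCover PSL(2, ℝ)) (α β : PSL(2, ℝ)) :
    commutatorLift (proj x * α * (proj x)⁻¹) (proj x * β * (proj x)⁻¹) =
      x * commutatorLift α β * x⁻¹ := by
  obtain ⟨a, rfl⟩ := proj_surjective α
  obtain ⟨b, rfl⟩ := proj_surjective β
  rw [← map_inv, ← map_mul, ← map_mul, ← map_mul, ← map_mul, commutatorLift_eq, commutatorLift_eq,
    conjugate_commutatorElement]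

lemma trace_conj_univCover (x y : UnivCover PSL(2, ℝ)) : trace (x * y * x⁻¹) = trace y := by
  rw [trace, toSL_eq_toSLHom, map_mul, map_mul, map_inv, trace_conj]
  rfl

theorem commutatorLift_mem_crossingRegion {α β : PSL(2, ℝ)}
    (h : trace (commutatorLift α β) < 2) : commutatorLift α β ∈ crossingRegion := by
  obtain ⟨hα, hβ⟩ := isHyperbolic_of_trace_commutatorLift h
  obtain ⟨g, l, B, hl, hB, rfl, rfl⟩ := exists_conj_pair hα hβ
  obtain ⟨x, rfl⟩ := proj_surjective g
  rw [commutatorLift_conj] at h ⊢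
  rw [trace_conj_univCover, trace_commutatorLift, trace_commutator_diagMatrix_lt_two_iff hl] at h
  rcases commutatorLift_diagMatrix_mem hl hB h with hpos | hneg
  · exact positiveRegion_subset (conj_mem_positiveRegion x hpos)
  · have := inv_mem_crossingRegion (conj_mem_positiveRegion x hneg)
    rwa [← conj_inv, inv_inv] at this

/-! ### Axes -/

instance : IsIsometricSMul PSL(2, ℝ) ℍ := ⟨fun g => by
  obtain ⟨A, rfl⟩ := ofSL_surjective g
  exact isometry_smul ℍ A⟩

lemma smul_mem_Axis_conj {α : PSL(2, ℝ)} (g : PSL(2, ℝ)) {z : ℍ} (h : z ∈ Axis α) :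
    g • z ∈ Axis (g * α * g⁻¹) := by
  obtain ⟨γ, hγ, ⟨t, rfl⟩, d, hd, hγd⟩ := h
  refine ⟨fun t => g • γ t, (isometry_smul ℍ g).comp hγ, ⟨t, rfl⟩, d, hd, fun s => ?_⟩
  change (g * α * g⁻¹) • g • γ s = g • γ (s + d)
  rw [← hγd, smul_smul, inv_mul_cancel_right, mul_smul]

lemma mem_Axis_conj_iff (α g : PSL(2, ℝ)) (z : ℍ) :
    z ∈ Axis (g * α * g⁻¹) ↔ g⁻¹ • z ∈ Axis α := by
  constructor
  · intro h
    have := smul_mem_Axis_conj g⁻¹ h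
    rwa [show g⁻¹ * (g * α * g⁻¹) * g⁻¹⁻¹ = α by group] at this
  · intro h
    have := smul_mem_Axis_conj g h
    rwa [smul_inv_smul] at this

lemma AxesCross.conj {α β : PSL(2, ℝ)} (h : AxesCross α β) (g : PSL(2, ℝ)) :
    AxesCross (g * α * g⁻¹) (g * β * g⁻¹) := by
  obtain ⟨z, hz⟩ := h
  refine ⟨g • z, Set.ext fun w => ?_⟩
  have := Set.ext_iff.1 hz (g⁻¹ • w)
  rw [Set.mem_inter_iff, mem_Axis_conj_iff, mem_Axis_conj_iff, ← Set.mem_inter_iff, this,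
    Set.mem_singleton_iff, Set.mem_singleton_iff, inv_smul_eq_iff]

lemma axesCross_conj_iff (α β g : PSL(2, ℝ)) :
    AxesCross (g * α * g⁻¹) (g * β * g⁻¹) ↔ AxesCross α β := by
  refine ⟨fun h => ?_, fun h => h.conj g⟩
  have := h.conj g⁻¹
  rwa [show g⁻¹ * (g * α * g⁻¹) * g⁻¹⁻¹ = α by group,
    show g⁻¹ * (g * β * g⁻¹) * g⁻¹⁻¹ = β by group] at this

lemma coe_mkSL_smul {a b c d : ℝ} (h : a * d - b * c = 1) (z : ℍ) :
    ((mkSL a b c d h • z : ℍ) : ℂ) = (a * z + b) / (c * z + d) := by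
  rw [UpperHalfPlane.coe_specialLinearGroup_apply]
  simp [mkSL]

lemma coe_diagMatrix_smul (l : ℝ) (z : ℍ) :
    ((ofSL (diagMatrix l) • z : ℍ) : ℂ) = (Real.exp (2 * l) : ℝ) * z := by
  rw [ofSL_smul, diagMatrix, coe_mkSL_smul]
  have : (Real.exp (2 * l) : ℝ) = Real.exp l / Real.exp (-l) := by
    rw [← Real.exp_sub]; ring_nf
  rw [this]
  push_cast
  field_simp
  simp

lemma cosh_dist_of_coe_eq {z w : ℍ} {μ : ℝ} (hμ : 0 < μ) (h : (w : ℂ) = μ * z) :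
    Real.cosh (dist z w) = 1 + (μ - 1) ^ 2 * (z.re ^ 2 + z.im ^ 2) / (2 * μ * z.im ^ 2) := by
  have hre : w.re = μ * z.re := by simpa using congrArg Complex.re h
  have him : w.im = μ * z.im := by simpa using congrArg Complex.im h
  have hz := z.im_pos
  rw [UpperHalfPlane.cosh_dist', hre, him]
  field_simp
  ring

/-- A point `z` on an axis satisfies `d(z, α²z) = 2 d(z, αz)`. For a dilation, the explicit
distances allow this only on the imaginary axis. -/
lemma Axis_diagMatrix {l : ℝ} (hl : l ≠ 0) : Axis (ofSL (diagMatrix l)) = {z | z.re = 0} := by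
  ext z
  constructor
  · rintro ⟨γ, hγ, ⟨t, rfl⟩, d, -, hd⟩
    set μ := Real.exp (2 * l)
    have hμ : 0 < μ := Real.exp_pos _
    have hμ1 : μ - 1 ≠ 0 := by
      rw [sub_ne_zero, Ne, Real.exp_eq_one_iff]
      simpa using hl
    have h1 : (γ (t + d) : ℂ) = μ * γ t := by rw [← hd, coe_diagMatrix_smul]
    have h2 : (γ (t + d + d) : ℂ) = (μ ^ 2 : ℝ) * γ t := by
      rw [← hd, coe_diagMatrix_smul, h1, Complex.ofReal_pow, sq, mul_assoc]
    have d1 := cosh_dist_of_coe_eq hμ h1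
    have d2 := cosh_dist_of_coe_eq (pow_pos hμ 2) h2
    have e : dist (γ t) (γ (t + d + d)) = 2 * dist (γ t) (γ (t + d)) := by
      rw [hγ.dist_eq, hγ.dist_eq, Real.dist_eq, Real.dist_eq,
        show t - (t + d + d) = 2 * (t - (t + d)) by ring, abs_mul, abs_two]
    rw [e, Real.cosh_two_mul, Real.sinh_sq, d1] at d2
    have hy := (γ t).im_pos
    set x := (γ t).re
    set y := (γ t).im
    -- With `cosh d = 1 + A` and `cosh 2d = 1 + B`, the duplication formula reads `B = 4 A + 2 A²`;
    -- clearing denominators leaves this product.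
    have key : x ^ 2 * ((μ - 1) ^ 4 * (x ^ 2 + y ^ 2)) = 0 := by
      set A := (μ - 1) ^ 2 * (x ^ 2 + y ^ 2) / (2 * μ * y ^ 2) with hA
      set B := (μ ^ 2 - 1) ^ 2 * (x ^ 2 + y ^ 2) / (2 * μ ^ 2 * y ^ 2) with hB
      rw [eq_div_iff (by positivity)] at hA hB
      linear_combination 2 * μ ^ 2 * y ^ 4 * d2 + y ^ 2 * hB -
        (4 * μ * y ^ 2 + A * (2 * μ * y ^ 2) + (μ - 1) ^ 2 * (x ^ 2 + y ^ 2)) * hA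
    have hpos : (μ - 1) ^ 4 * (x ^ 2 + y ^ 2) ≠ 0 := by positivity
    exact pow_eq_zero_iff two_ne_zero |>.1 ((mul_eq_zero.1 key).resolve_right hpos)
  · intro hz
    refine ⟨_, UpperHalfPlane.isometry_vertical_line 0, ⟨Real.log z.im, ?_⟩, 2 * l, by simpa,
      fun t => ?_⟩
    · ext1
      apply Complex.ext
      · exact hz.symm
      · exact Real.exp_log z.im_pos
    · ext1
      rw [coe_diagMatrix_smul]
      apply Complex.ext
      · rw [Complex.re_ofReal_mul]
        exact mul_zero _
      · rw [Complex.im_ofReal_mul]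
        change Real.exp (2 * l) * Real.exp t = Real.exp (t + 2 * l)
        rw [add_comm, Real.exp_add]

/-- The equation is that of the half-circle or vertical line orthogonal to the real axis, whose
endpoints are the roots of the fixed-point equation `c x² + (d - a) x - b = 0` (one of them `∞` if
`c = 0`). It is obtained by transporting `Re = 0` through the diagonalising conjugation. -/
lemma mem_Axis_iff {B : SL(2, ℝ)} (hB : 2 < B.1.trace) (z : ℍ) :
    z ∈ Axis (ofSL B) ↔
      B 1 0 * (z.re ^ 2 + z.im ^ 2) + (B 1 1 - B 0 0) * z.re - B 0 1 = 0 := by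
  obtain ⟨g, m, hm, rfl⟩ := exists_conj_diagMatrix hB
  obtain ⟨p, q, r, s, hg, rfl⟩ := exists_eq_mkSL g
  rw [map_mul, map_mul, map_inv, mem_Axis_conj_iff, Axis_diagMatrix hm, conj_diagMatrix,
    Set.mem_ofPred_eq, ← map_inv, ofSL_smul, mkSL_inv]
  have hS := exp_sub_exp_neg_ne_zero hm
  have h0 : Complex.normSq (-r * z + p) ≠ 0 := by
    rw [Ne, Complex.normSq_eq_zero]
    intro h0
    have him : r = 0 := by
      have := congrArg Complex.im h0
      simpa [z.im_pos.ne'] using this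
    have hp : p = 0 := by
      have := congrArg Complex.re h0
      simpa [him] using this
    simp [him, hp] at hg
  have hre : (mkSL s (-q) (-r) p (by linear_combination hg) • z).re *
      Complex.normSq (-r * z + p) =
      (p * s + q * r) * z.re - r * s * (z.re ^ 2 + z.im ^ 2) - p * q := by
    rw [← UpperHalfPlane.coe_re, coe_mkSL_smul, Complex.ofReal_neg, Complex.ofReal_neg,
      Complex.div_re, add_mul, div_mul_cancel₀ _ h0, div_mul_cancel₀ _ h0]
    simp
    ring
  rw [← mul_eq_zero_iff_right h0, hre, ← mul_eq_zero_iff_left hS (b := _ - _)]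
  rw [mkSL_zero_one, mkSL_one_zero]
  change _ ↔ _ + ((p * s * Real.exp (-m) - q * r * Real.exp m) -
    (p * s * Real.exp m - q * r * Real.exp (-m))) * _ - _ = 0
  rw [← neg_eq_zero]
  ring_nf

lemma axesCross_diagMatrix_iff {l : ℝ} (hl : l ≠ 0) {B : SL(2, ℝ)} (hB : 2 < B.1.trace) :
    AxesCross (ofSL (diagMatrix l)) (ofSL B) ↔ 0 < B 0 1 * B 1 0 := by
  have hmem : ∀ z : ℍ, z ∈ Axis (ofSL (diagMatrix l)) ∩ Axis (ofSL B) ↔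
      z.re = 0 ∧ B 1 0 * z.im ^ 2 = B 0 1 := by
    intro z
    rw [Set.mem_inter_iff, Axis_diagMatrix hl, mem_Axis_iff hB, Set.mem_ofPred_eq]
    refine and_congr_right fun hz => ?_
    rw [hz]
    constructor <;> intro h <;> linarith
  constructor
  · rintro ⟨z, hz⟩
    have hz1 := (hmem z).1 (hz ▸ Set.mem_singleton z)
    have hy := z.im_pos
    by_cases hc : B 1 0 = 0
    · exfalso
      have hb : B 0 1 = 0 := by rw [← hz1.2, hc, zero_mul]
      -- If `b = c = 0` the two axes coincide, and `2 i Im z` is a second common point.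
      have h2 : (⟨⟨0, 2 * z.im⟩, by simpa using hy⟩ : ℍ) ∈
          Axis (ofSL (diagMatrix l)) ∩ Axis (ofSL B) :=
        (hmem _).2 ⟨rfl, by rw [hc, hb, zero_mul]⟩
      rw [hz] at h2
      have h3 : 2 * z.im = z.im := congrArg UpperHalfPlane.im h2
      linarith
    · rw [← hz1.2]
      have : 0 < B 1 0 ^ 2 * z.im ^ 2 := by positivity
      linarith
  · intro h
    have hc : B 1 0 ≠ 0 := fun h0 => by simp [h0] at h
    have hpos : 0 < B 0 1 / B 1 0 := by
      rw [div_eq_mul_inv]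
      have : B 0 1 * (B 1 0)⁻¹ = B 0 1 * B 1 0 * ((B 1 0)⁻¹) ^ 2 := by field_simp
      rw [this]
      positivity
    refine ⟨⟨⟨0, √(B 0 1 / B 1 0)⟩, by simpa using hpos⟩, Set.ext fun z => ?_⟩
    rw [hmem, Set.mem_singleton_iff, UpperHalfPlane.ext_iff, Complex.ext_iff]
    refine and_congr_right fun hz => ?_
    change _ ↔ z.im = _
    rw [eq_comm (a := z.im), Real.sqrt_eq_iff_mul_self_eq hpos.le z.im_pos.le, div_eq_iff hc]
    constructor <;> intro h <;> linarith

theorem axesCross_iff_trace_lt_two {α β : PSL(2, ℝ)} (hα : IsHyperbolic α) (hβ : IsHyperbolic β) :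
    AxesCross α β ↔ trace (commutatorLift α β) < 2 := by
  obtain ⟨g, l, B, hl, hB, rfl, rfl⟩ := exists_conj_pair hα hβ
  obtain ⟨x, rfl⟩ := proj_surjective g
  rw [axesCross_conj_iff, axesCross_diagMatrix_iff hl hB, commutatorLift_conj, trace_conj_univCover,
    trace_commutatorLift, trace_commutator_diagMatrix_lt_two_iff hl]

end PSL2

end

theorem mainTheorem7 (α β : PSL(2, ℝ)) :
    List.TFAE [
      PSL2.IsHyperbolic α ∧ PSL2.IsHyperbolic β ∧ PSL2.AxesCross α β,
      PSL2.commutatorLift α β ∈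
        (PSL2.EllOne ∪ PSL2.EllNegOne) ∪ (PSL2.ParMinus 1 ∪ PSL2.ParPlus (-1)) ∪
          (PSL2.Hyp 1 ∪ PSL2.Hyp (-1)),
      PSL2.trace (PSL2.commutatorLift α β) < 2] := by
  tfae_have 1 → 3 := fun ⟨hα, hβ, h⟩ => (PSL2.axesCross_iff_trace_lt_two hα hβ).1 h
  tfae_have 3 → 2 := PSL2.commutatorLift_mem_crossingRegion
  tfae_have 2 → 3 := PSL2.trace_lt_two_of_mem_crossingRegion
  tfae_have 3 → 1 := fun h =>
    have hαβ := PSL2.isHyperbolic_of_trace_commutatorLift h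
    ⟨hαβ.1, hαβ.2, (PSL2.axesCross_iff_trace_lt_two hαβ.1 hαβ.2).2 h⟩
  tfae_finish
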